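/- Let $r>0$, $c_T>0$ with $r\neq c_T$, $0<x^*<B$, $\lambda>0$, $\delta\ge 0$, and put $x^{**}=\frac{c_TB-rx^*}{r-c_T}$. Let $X=(X_t)_{t\ge0}$, $X_0=x\ge x^*$, be the capital process that solves $\frac{dX_t}{dt}=r[X_t-x^*]^++c_T[B-X_t]^+$ between the points of a Poisson process of intensity $\lambda$ and is multiplied by $Z_i$ at the $i$-th point, where $Z_1,Z_2,\dots$ are i.i.d. with values in $[0,1]$ and distribution function $G_Z$, independent of the Poisson process. Let $\tau_x=\inf\{t\ge0:X_t<x^*\}$ (with $\inf\emptyset=\infty$), let $w\ge0$ be a measurable penalty function on $[0,\infty)\times(0,x^*]$, and let $$m_\delta(x)=\mathbb E\big[w(X_{\tau_x-}-x^*,|X_{\tau_x}-x^*|)\,e^{-\delta\tau_x}\mathbb 1_{\{\tau_x<\infty\}}\big],\qquad x\ge x^*,$$ which is assumed to be finite for every $x\ge x^*$ (as it is when $w$ is bounded). Write $m_{\delta,u}$ for the restriction of $m_\delta$ to $[B,\infty)$ and $m_{\delta,l}$ for its restriction to $[x^*,B)$; primes are derivatives on these intervals (one-sided at $B$ and at $x^*$).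 Put $A(u)=\int_{[0,x^*/u)}w(u-x^*,x^*-uz)\,dG_Z(z)$ for $u\ge x^*$, assumed finite. (i) Let $x\ge B$ be such that $\mathbb P(Z_1=x^*/x)=0$ and $A|_{[B,\infty)}$ is continuous at $x$. Then $m_{\delta,u}$ is differentiable at $x$, the integrals below converge, and $$r(x-x^*)m_{\delta,u}'(x)-(\lambda+\delta)m_{\delta,u}(x)+\lambda\Big[\int_{[B/x,1]}m_{\delta,u}(xz)\,dG_Z(z)+\int_{[x^*/x,B/x)}m_{\delta,l}(xz)\,dG_Z(z)+A(x)\Big]=0.$$ (ii) Let $x^*\le x<B$ be such that $\mathbb P(Z_1=x^*/x)=0$ and $A|_{[x^*,B)}$ is continuous at $x$. Then $m_{\delta,l}$ is differentiable at $x$, the integral below converges, and $$(r-c_T)(x+x^{**})m_{\delta,l}'(x)-(\lambda+\delta)m_{\delta,l}(x)+\lambda\Big[\int_{[x^*/x,1]}m_{\delta,l}(xz)\,dG_Z(z)+A(x)\Big]=0.$$ If $G_Z$ is continuous and $w$ is bounded and continuous, then $A$ is continuous on $[x^*,\infty)$, so that (i) and (ii) hold at every $x\ge B$, respectively every $x\in[x^*,B)$.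 (iii) Boundary conditions: $m_{\delta,u}(B)=\lim_{x\uparrow B}m_{\delta,l}(x)$. If $w$ is bounded, $\mathbb P(Z_1=0)=0$, and either $\delta>0$ or the net profit condition $\lambda\,\mathbb E[-\log Z_1]<r$ holds, then $\lim_{x\to\infty}m_{\delta,u}(x)=0$. If $\mathbb P(Z_1=1)=0$ and $A|_{[x^*,B)}$ is continuous at $x^*$, then $$m_{\delta,l}(x^*)=\frac1{\lambda+\delta}\big[c_T(B-x^*)\,m_{\delta,l}'(x^*)+\lambda A(x^*)\big].$$ -/

import Mathlib

open Set Filter Topology MeasureTheory ProbabilityTheory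

noncomputable section

/-- Parameters of the capital model: growth rate `r`, critical capital `xs` (`x*`), transfer rate
`cT` and capital barrier level `B`. -/
structure CapitalParams where
  r : ℝ
  xs : ℝ
  cT : ℝ
  B : ℝ

namespace CapitalParams

variable (p : CapitalParams)

/-- The standing assumptions on the parameters; `r ≠ cT` is what makes `x**` meaningful. -/
structure Admissible : Prop where
  r_pos : 0 < p.r
  xs_pos : 0 < p.xs
  xs_lt_B : p.xs < p.B
  cT_pos : 0 < p.cT
  r_ne_cT : p.r ≠ p.cT

/-- `x** = (c_T B - r x*) / (r - c_T)`. -/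
def xss : ℝ := (p.cT * p.B - p.r * p.xs) / (p.r - p.cT)

/-- The growth speed of the capital between losses, `r [y - x*]⁺ + c_T [B - y]⁺`. -/
def drift (y : ℝ) : ℝ := p.r * max (y - p.xs) 0 + p.cT * max (p.B - y) 0

/-- Growth started from `y ≥ B`. -/
def flowTop (y t : ℝ) : ℝ := (y - p.xs) * Real.exp (p.r * t) + p.xs

/-- The time the growth needs from `y ∈ [x*, B)` to `B`. -/
def timeToB (y : ℝ) : ℝ := Real.log ((p.B + p.xss) / (y + p.xss)) / (p.r - p.cT)

/-- Growth started from `y ∈ [x*, B)`. -/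
def flowMid (y t : ℝ) : ℝ :=
  if t < p.timeToB y then (y + p.xss) * Real.exp ((p.r - p.cT) * t) - p.xss
  else p.flowTop p.B (t - p.timeToB y)

/-- The time the growth needs from `y < x*` to `x*`. -/
def timeToXs (y : ℝ) : ℝ := Real.log ((p.B - y) / (p.B - p.xs)) / p.cT

/-- Growth started from `y < x*`. -/
def flowLow (y t : ℝ) : ℝ :=
  if t < p.timeToXs y then p.B - (p.B - y) * Real.exp (-p.cT * t)
  else p.flowMid p.xs (t - p.timeToXs y)

/-- The capital after a time `t ≥ 0` without losses, started from `y`. It is the solution of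
`dX/dt = r [X - x*]⁺ + c_T [B - X]⁺`, `X_0 = y`; see `flow_zero` and `hasDerivWithinAt_flow`. -/
def flow (y t : ℝ) : ℝ :=
  if p.B ≤ y then p.flowTop y t else if p.xs ≤ y then p.flowMid y t else p.flowLow y t

end CapitalParams

namespace CapitalParams

variable {p : CapitalParams}

theorem glue {f g : ℝ → ℝ} {v : ℝ → ℝ} {s : ℝ} (hs : 0 < s)
    (hf : ∀ t, 0 ≤ t → t ≤ s → HasDerivAt f (v (f t)) t)
    (hg : ∀ t, 0 ≤ t → HasDerivWithinAt g (v (g t)) (Ici 0) t)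
    (hfg : f s = g 0) (t : ℝ) (ht : 0 ≤ t) :
    HasDerivWithinAt (fun u => if u < s then f u else g (u - s))
      (v (if t < s then f t else g (t - s))) (Ici 0) t := by
  have hgs : ∀ t, s ≤ t →
      HasDerivWithinAt (fun u => g (u - s)) (v (g (t - s))) (Ici s) t := by
    intro t hst
    have hmaps : MapsTo (fun u : ℝ => u - s) (Ici s) (Ici 0) := fun u hu => by
      have : s ≤ u := hu
      simpa using this
    have h := HasDerivWithinAt.scomp t (hg (t - s) (by linarith))
      (((hasDerivAt_id t).sub_const s).hasDerivWithinAt (s := Ici s)) hmaps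
    simpa [Function.comp_def] using h
  rcases lt_trichotomy t s with h | h | h
  · rw [if_pos h]
    refine ((hf t ht h.le).congr_of_eventuallyEq ?_).hasDerivWithinAt
    filter_upwards [Iio_mem_nhds h] with u hu
    exact if_pos hu
  · subst h
    rw [if_neg (lt_irrefl _), sub_self]
    have h1 : HasDerivWithinAt (fun u => if u < t then f u else g (u - t)) (v (g 0)) (Iic t) t := by
      rw [← hfg]
      refine (hf t ht le_rfl).hasDerivWithinAt.congr (fun u hu => ?_) ?_
      · rcases lt_or_eq_of_le (show u ≤ t from hu) with h | h
        · simp [h]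
        · subst h; simp [hfg]
      · simp [hfg]
    have h2 : HasDerivWithinAt (fun u => if u < t then f u else g (u - t)) (v (g 0)) (Ici t) t := by
      have := hgs t le_rfl
      rw [sub_self] at this
      refine this.congr (fun u hu => ?_) ?_
      · rw [if_neg (not_lt.2 hu)]
      · simp
    exact (h1.union h2).mono (fun u _ => le_total u t)
  · rw [if_neg (not_lt.2 h.le)]
    have := (hgs t h.le).hasDerivAt (Ici_mem_nhds h)
    refine (this.congr_of_eventuallyEq ?_).hasDerivWithinAt
    filter_upwards [Ioi_mem_nhds h] with u hu
    rw [if_neg (not_lt.2 (le_of_lt hu))]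

theorem mid_eq (h : p.Admissible) (y : ℝ) :
    (p.r - p.cT) * (y + p.xss) = p.r * (y - p.xs) + p.cT * (p.B - y) := by
  have := sub_ne_zero.2 h.r_ne_cT
  unfold xss
  field_simp
  ring

theorem mid_pos (h : p.Admissible) {y : ℝ} (h1 : p.xs ≤ y) (h2 : y ≤ p.B) :
    0 < (p.r - p.cT) * (y + p.xss) := by
  rw [mid_eq h]
  have := h.r_pos; have := h.cT_pos; have := h.xs_lt_B
  rcases eq_or_lt_of_le h2 with h2 | h2
  · subst h2; nlinarith
  · have : 0 < p.cT * (p.B - y) := by apply mul_pos <;> linarith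
    have : 0 ≤ p.r * (y - p.xs) := by apply mul_nonneg <;> linarith
    linarith

theorem timeToB_pos (h : p.Admissible) {y : ℝ} (h1 : p.xs ≤ y) (h2 : y < p.B) :
    0 < p.timeToB y := by
  have a := mid_pos h h1 h2.le
  have b := mid_pos h h.xs_lt_B.le le_rfl
  unfold timeToB
  rcases lt_or_gt_of_ne (sub_ne_zero.2 h.r_ne_cT) with hk | hk
  · have a' : y + p.xss < 0 := by nlinarith
    have b' : p.B + p.xss < 0 := by nlinarith
    apply div_pos_of_neg_of_neg _ hk
    apply Real.log_neg (div_pos_of_neg_of_neg b' a')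
    rw [div_lt_one_of_neg a']
    linarith
  · have a' : 0 < y + p.xss := by nlinarith
    apply div_pos _ hk
    apply Real.log_pos
    rw [lt_div_iff₀ a']
    linarith

theorem exp_timeToB (h : p.Admissible) {y : ℝ} (h1 : p.xs ≤ y) (h2 : y < p.B) :
    (y + p.xss) * Real.exp ((p.r - p.cT) * p.timeToB y) = p.B + p.xss := by
  have a := mid_pos h h1 h2.le
  have b := mid_pos h h.xs_lt_B.le le_rfl
  have hk := sub_ne_zero.2 h.r_ne_cT
  have hy : y + p.xss ≠ 0 := by rintro h0; simp [h0] at a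
  have hpos : 0 < (p.B + p.xss) / (y + p.xss) := by
    have := div_pos b a
    rwa [mul_div_mul_left _ _ hk] at this
  unfold timeToB
  rw [mul_div_cancel₀ _ hk, Real.exp_log hpos]
  field_simp

theorem hasDerivWithinAt_flowTop (h : p.Admissible) {y : ℝ} (hy : p.B ≤ y) (t : ℝ)
    (ht : 0 ≤ t) :
    HasDerivWithinAt (p.flowTop y) (p.drift (p.flowTop y t)) (Ici 0) t := by
  have hr := h.r_pos
  have hB := h.xs_lt_B
  have he : 1 ≤ Real.exp (p.r * t) := Real.one_le_exp (by positivity)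
  have h1 : p.B ≤ p.flowTop y t := by unfold flowTop; nlinarith
  have h2 : p.drift (p.flowTop y t) = (y - p.xs) * (Real.exp (p.r * t) * (p.r * 1)) := by
    unfold drift
    rw [max_eq_left (by linarith), max_eq_right (by linarith)]
    unfold flowTop
    ring
  rw [h2]
  exact ((((hasDerivAt_id t).const_mul p.r).exp.const_mul (y - p.xs)).add_const
    p.xs).hasDerivWithinAt

theorem hasDerivWithinAt_flowMid (h : p.Admissible) {y : ℝ} (h1 : p.xs ≤ y) (h2 : y < p.B)
    (t : ℝ) (ht : 0 ≤ t) :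
    HasDerivWithinAt (p.flowMid y) (p.drift (p.flowMid y t)) (Ici 0) t := by
  have hk := sub_ne_zero.2 h.r_ne_cT
  refine glue (v := p.drift) (f := fun t => (y + p.xss) * Real.exp ((p.r - p.cT) * t) - p.xss)
    (timeToB_pos h h1 h2) ?_ (hasDerivWithinAt_flowTop h le_rfl) ?_ t ht
  · intro t ht0 ht1
    have a := mid_pos h h1 h2.le
    have hE := exp_timeToB h h1 h2
    have hx : p.xs ≤ (y + p.xss) * Real.exp ((p.r - p.cT) * t) - p.xss ∧
        (y + p.xss) * Real.exp ((p.r - p.cT) * t) - p.xss ≤ p.B := by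
      rcases lt_or_gt_of_ne hk with hk | hk
      · have a' : y + p.xss < 0 := by nlinarith
        have e1 : Real.exp ((p.r - p.cT) * t) ≤ 1 := Real.exp_le_one_iff.2 (by nlinarith)
        have e2 : Real.exp ((p.r - p.cT) * p.timeToB y) ≤ Real.exp ((p.r - p.cT) * t) :=
          Real.exp_le_exp.2 (by nlinarith)
        constructor <;> nlinarith
      · have a' : 0 < y + p.xss := by nlinarith
        have e1 : 1 ≤ Real.exp ((p.r - p.cT) * t) := Real.one_le_exp (by positivity)
        have e2 : Real.exp ((p.r - p.cT) * t) ≤ Real.exp ((p.r - p.cT) * p.timeToB y) :=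
          Real.exp_le_exp.2 (by nlinarith)
        constructor <;> nlinarith
    have hd : p.drift ((y + p.xss) * Real.exp ((p.r - p.cT) * t) - p.xss) =
        (y + p.xss) * (Real.exp ((p.r - p.cT) * t) * ((p.r - p.cT) * 1)) := by
      unfold drift
      rw [max_eq_left (by linarith [hx.1]), max_eq_left (by linarith [hx.2]), ← mid_eq h]
      ring
    rw [hd]
    exact (((hasDerivAt_id t).const_mul (p.r - p.cT)).exp.const_mul (y + p.xss)).sub_const p.xss
  · simp only [exp_timeToB h h1 h2, flowTop]
    simp

theorem timeToXs_pos (h : p.Admissible) {y : ℝ} (hy : y < p.xs) : 0 < p.timeToXs y := by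
  have hB := h.xs_lt_B
  apply div_pos _ h.cT_pos
  apply Real.log_pos
  rw [lt_div_iff₀ (by linarith)]
  linarith

theorem hasDerivWithinAt_flowLow (h : p.Admissible) {y : ℝ} (hy : y < p.xs) (t : ℝ)
    (ht : 0 ≤ t) :
    HasDerivWithinAt (p.flowLow y) (p.drift (p.flowLow y t)) (Ici 0) t := by
  have hB := h.xs_lt_B
  have hc := h.cT_pos
  have hE : (p.B - y) * Real.exp (-p.cT * p.timeToXs y) = p.B - p.xs := by
    have hpos : 0 < (p.B - y) / (p.B - p.xs) := div_pos (by linarith) (by linarith)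
    have : p.B - y ≠ 0 := by linarith
    have : p.B - p.xs ≠ 0 := by linarith
    unfold timeToXs
    rw [neg_mul, mul_div_cancel₀ _ hc.ne', Real.exp_neg, Real.exp_log hpos]
    field_simp
  refine glue (v := p.drift) (f := fun t => p.B - (p.B - y) * Real.exp (-p.cT * t))
    (timeToXs_pos h hy) ?_ (hasDerivWithinAt_flowMid h le_rfl hB) ?_ t ht
  · intro t ht0 ht1
    have e2 : Real.exp (-p.cT * p.timeToXs y) ≤ Real.exp (-p.cT * t) :=
      Real.exp_le_exp.2 (by nlinarith)
    have e3 := Real.exp_pos (-p.cT * t)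
    have hd : p.drift (p.B - (p.B - y) * Real.exp (-p.cT * t)) =
        -((p.B - y) * (Real.exp (-p.cT * t) * (-p.cT * 1))) := by
      unfold drift
      rw [max_eq_right (by nlinarith), max_eq_left (by nlinarith)]
      ring
    rw [hd]
    exact (((hasDerivAt_id t).const_mul (-p.cT)).exp.const_mul (p.B - y)).const_sub p.B
  · simp only [hE, flowMid, timeToB_pos h le_rfl hB, if_true]
    simp

theorem flow_zero (h : p.Admissible) (y : ℝ) : p.flow y 0 = y := by
  unfold flow
  split_ifs with h1 h2
  · simp [flowTop]
  · simp [flowMid, timeToB_pos h h2 (not_le.1 h1)]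
  · simp [flowLow, timeToXs_pos h (not_le.1 h2)]

/-- The flow solves `dX/dt = r [X - x*]⁺ + c_T [B - X]⁺` on `[0, ∞)`. -/
theorem hasDerivWithinAt_flow (h : p.Admissible) (y t : ℝ) (ht : 0 ≤ t) :
    HasDerivWithinAt (p.flow y) (p.drift (p.flow y t)) (Ici 0) t := by
  by_cases h1 : p.B ≤ y
  · have : p.flow y = p.flowTop y := by funext s; simp [flow, h1]
    rw [this]
    exact hasDerivWithinAt_flowTop h h1 t ht
  by_cases h2 : p.xs ≤ y
  · have : p.flow y = p.flowMid y := by funext s; simp [flow, h1, h2]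
    rw [this]
    exact hasDerivWithinAt_flowMid h h2 (not_le.1 h1) t ht
  · have : p.flow y = p.flowLow y := by funext s; simp [flow, h1, h2]
    rw [this]
    exact hasDerivWithinAt_flowLow h (not_le.1 h2) t ht

end CapitalParams

namespace CapitalParams

variable (p : CapitalParams)

/-- The time `W 0 + ... + W (n - 1)` of the `n`-th loss, for waiting times `W i` between losses. -/
def lossTime (W : ℕ → ℝ) (n : ℕ) : ℝ := ∑ i ∈ Finset.range n, W i

/-- The number of losses up to time `t`; a Poisson process when the `W i` are i.i.d.
exponential. -/
def lossCount (W : ℕ → ℝ) (t : ℝ) : ℕ := {n : ℕ | lossTime W (n + 1) ≤ t}.ncard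

/-- The capital right after the `n`-th loss (for `n = 0`, the initial capital `x`): after the waiting
time `W n` the capital is multiplied by the remaining proportion `Z n`. -/
def afterLoss (W Z : ℕ → ℝ) (x : ℝ) : ℕ → ℝ
  | 0 => x
  | n + 1 => Z n * p.flow (afterLoss W Z x n) (W n)

/-- The capital `X_t`, with `X_0 = x`. -/
def capital (W Z : ℕ → ℝ) (x t : ℝ) : ℝ :=
  p.flow (p.afterLoss W Z x (lossCount W t)) (t - lossTime W (lossCount W t))

/-- The times at which the capital is below `x*`. -/
def poorTimes (W Z : ℕ → ℝ) (x : ℝ) : Set ℝ := {t | 0 ≤ t ∧ p.capital W Z x t < p.xs}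

/-- The trapping time `τ_x`. It is infinite when `poorTimes` is empty; that case is treated
separately in `discountedPenalty`. -/
def trappingTime (W Z : ℕ → ℝ) (x : ℝ) : ℝ := sInf (p.poorTimes W Z x)

open Classical in
/-- `w(X_{τ-} - x*, |X_τ - x*|) e^{-δ τ} 1_{τ < ∞}` along one trajectory. -/
def discountedPenalty (w : ℝ → ℝ → ℝ) (δ : ℝ) (W Z : ℕ → ℝ) (x : ℝ) : ℝ :=
  if (p.poorTimes W Z x).Nonempty then
    w (Function.leftLim (p.capital W Z x) (p.trappingTime W Z x) - p.xs)
        |p.capital W Z x (p.trappingTime W Z x) - p.xs|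
      * Real.exp (-δ * p.trappingTime W Z x)
  else 0

/-- The expected discounted penalty function `m_δ(x)`. -/
def expectedPenalty {Ω : Type*} [MeasurableSpace Ω] (P : Measure Ω) (W Z : ℕ → Ω → ℝ)
    (w : ℝ → ℝ → ℝ) (δ x : ℝ) : ℝ :=
  ∫ ω, p.discountedPenalty w δ (fun i => W i ω) (fun i => Z i ω) x ∂P

/-- `A(u) = ∫_0^{x*/u} w(u - x*, x* - u z) dG_Z(z)`, where `ν` is the law with distribution
function `G_Z`. -/
def trappingLoss (ν : Measure ℝ) (w : ℝ → ℝ → ℝ) (u : ℝ) : ℝ :=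
  ∫ z in Ico 0 (p.xs / u), w (u - p.xs) (p.xs - u * z) ∂ν

end CapitalParams

/-- The random input of the model: the losses occur at the points of a Poisson process of intensity
`lam` (i.i.d. exponential waiting times `W i`), the remaining proportions `Z i` are i.i.d. with
law `ν`, and the two families are independent. -/
structure IsLossInput {Ω : Type*} [MeasurableSpace Ω] (P : Measure Ω) (lam : ℝ) (ν : Measure ℝ)
    (W Z : ℕ → Ω → ℝ) : Prop where
  measurable_wait : ∀ i, Measurable (W i)
  measurable_prop : ∀ i, Measurable (Z i)
  law_wait : ∀ i, P.map (W i) = expMeasure lam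
  law_prop : ∀ i, P.map (Z i) = ν
  indep : iIndepFun (Sum.elim W Z : ℕ ⊕ ℕ → Ω → ℝ) P

end

/-! Condition on the first loss. Let `φ` be the growth and `H(u) = A(u) + ∫_{[x*/u, 1]} m(uz)
dG_Z(z)` the expected penalty when a loss strikes at capital `u`. A loss that does not trap the
capital restarts the process, so `m(x) = ∫_0^∞ λ e^{-(λ+δ)t} H(φ(x,t)) dt` (`meanPenalty_eq`). Every
`x ≥ x*` lies on the single trajectory that starts at `x*`, and the semigroup property turns the
equation into `m(φ(x*,t)) = e^{(λ+δ)t} ∫_t^∞ λ e^{-(λ+δ)s} H(φ(x*,s)) ds` (`meanPenalty_flow_xs`,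
`lossDensity_renewal`), where `t` enters only through the exponential and the limit of integration.

Regularity then bootstraps. Integrability alone makes the right side continuous in `t`, hence `m` is
continuous (`continuousOn_realPenalty`). So the integral in `H` is continuous at `x` when `Z` has no
atom at `x*/x` (`continuousWithinAt_survivalMean`). If `A` is continuous there too, the fundamental
theorem of calculus gives `d/dt m = (λ+δ) m - λ H` along the trajectory
(`hasDerivWithinAt_realPenalty_flow`). Composing with the hitting time `hit`, whose derivative is
one over the speed of growth, yields (i) and (ii); they differ only in the formula for the speed.
The relation at `x*` is (ii) with the integral reduced to the null set `{1}`.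

The limit at infinity is proved path by path. Even without transfers, a loss costs the excess over
`x*` at most an additive `x*` besides the factor `Z`, so the first `n` losses do not trap once `x -
x*` exceeds `x*` times a partial sum of inverse growth factors (`growthFactor_mul_le`). For `δ > 0`
the discount makes late trapping negligible; under the net profit condition the law of large numbers
makes the whole series converge, so that a large initial capital is never trapped. Dominated
convergence passes to the expectation.

The renewal equation is derived in `[0, ∞]`, with the penalty written as a series over the number of
the trapping loss, so that Tonelli's theorem applies without integrability conditions. -/

namespace CapitalParams

variable {p : CapitalParams}

/-! ### The deterministic growth -/

theorem continuousOn_flow (h : p.Admissible) (y : ℝ) : ContinuousOn (p.flow y) (Ici 0) :=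
  fun t ht => (hasDerivWithinAt_flow h y t ht).continuousWithinAt

/-- The drift is at least `r (y - x*)` at every `y`, so `(flow - x*) e^{-rt}` is nondecreasing. This
comparison keeps the growth above `x*` and bounds it from below for large capital. -/
theorem flowTop_le_flow (h : p.Admissible) (y : ℝ) {t : ℝ} (ht : 0 ≤ t) :
    p.flowTop y t ≤ p.flow y t := by
  have hder : ∀ s, 0 ≤ s → HasDerivWithinAt (fun s => (p.flow y s - p.xs) * Real.exp (-p.r * s))
      (p.drift (p.flow y s) * Real.exp (-p.r * s)
        + (p.flow y s - p.xs) * (Real.exp (-p.r * s) * (-p.r * 1))) (Ici 0) s := fun s hs =>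
    ((hasDerivWithinAt_flow h y s hs).sub_const p.xs).mul
      ((hasDerivAt_id s).const_mul (-p.r)).exp.hasDerivWithinAt
  have hmono : MonotoneOn (fun s => (p.flow y s - p.xs) * Real.exp (-p.r * s)) (Ici 0) := by
    refine monotoneOn_of_deriv_nonneg (convex_Ici 0)
      (fun s hs => (hder s hs).continuousWithinAt) (fun s hs => ?_) (fun s hs => ?_)
    · rw [interior_Ici] at hs
      exact ((hder s (le_of_lt hs)).hasDerivAt
        (Ici_mem_nhds hs)).differentiableAt.differentiableWithinAt
    · rw [interior_Ici] at hs
      rw [((hder s (le_of_lt hs)).hasDerivAt (Ici_mem_nhds hs)).deriv]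
      have h1 : p.r * (p.flow y s - p.xs) ≤ p.drift (p.flow y s) := by
        unfold drift
        have := mul_le_mul_of_nonneg_left (le_max_left (p.flow y s - p.xs) 0) h.r_pos.le
        have := mul_nonneg h.cT_pos.le (le_max_right (p.B - p.flow y s) 0)
        linarith
      have := mul_le_mul_of_nonneg_right h1 (Real.exp_pos (-p.r * s)).le
      linarith
  have h0 := hmono (mem_Ici.2 le_rfl) (mem_Ici.2 ht) ht
  simp only [flow_zero h, mul_zero, Real.exp_zero, mul_one, neg_mul] at h0
  have h1 := mul_le_mul_of_nonneg_right h0 (Real.exp_pos (p.r * t)).le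
  rw [mul_assoc, ← Real.exp_add, neg_add_cancel, Real.exp_zero, mul_one] at h1
  unfold flowTop
  linarith

theorem le_flow (h : p.Admissible) {y t : ℝ} (hy : p.xs ≤ y) (ht : 0 ≤ t) : p.xs ≤ p.flow y t := by
  refine le_trans ?_ (flowTop_le_flow h y ht)
  unfold flowTop
  have := mul_nonneg (sub_nonneg.2 hy) (Real.exp_pos (p.r * t)).le
  linarith

theorem measurable_flow : Measurable (fun q : ℝ × ℝ => p.flow q.1 q.2) := by
  have hB : Measurable p.timeToB := by unfold timeToB; fun_prop
  have hX : Measurable p.timeToXs := by unfold timeToXs; fun_prop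
  have hTop : Measurable (fun q : ℝ × ℝ => p.flowTop q.1 q.2) := by unfold flowTop; fun_prop
  have hMid : Measurable (fun q : ℝ × ℝ => p.flowMid q.1 q.2) := by
    unfold flowMid
    refine Measurable.ite (measurableSet_lt measurable_snd (by fun_prop)) (by fun_prop) ?_
    exact hTop.comp (g := fun q : ℝ × ℝ => p.flowTop q.1 q.2)
      (f := fun q : ℝ × ℝ => (p.B, q.2 - p.timeToB q.1)) (by fun_prop)
  have hLow : Measurable (fun q : ℝ × ℝ => p.flowLow q.1 q.2) := by
    unfold flowLow
    refine Measurable.ite (measurableSet_lt measurable_snd (by fun_prop)) (by fun_prop) ?_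
    exact hMid.comp (g := fun q : ℝ × ℝ => p.flowMid q.1 q.2)
      (f := fun q : ℝ × ℝ => (p.xs, q.2 - p.timeToXs q.1)) (by fun_prop)
  unfold flow
  exact Measurable.ite (measurableSet_le measurable_const measurable_fst) hTop
    (Measurable.ite (measurableSet_le measurable_const measurable_fst) hMid hLow)

theorem Measurable.flow {α : Type*} [MeasurableSpace α] {f g : α → ℝ} (hf : Measurable f)
    (hg : Measurable g) : Measurable fun a => p.flow (f a) (g a) :=
  measurable_flow.comp (hf.prodMk hg)

theorem flow_xs_of_lt (h : p.Admissible) {t : ℝ} (ht : t < p.timeToB p.xs) :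
    p.flow p.xs t = (p.xs + p.xss) * Real.exp ((p.r - p.cT) * t) - p.xss := by
  simp [flow, flowMid, h.xs_lt_B, ht]

theorem flow_xs_of_ge (h : p.Admissible) {t : ℝ} (ht : p.timeToB p.xs ≤ t) :
    p.flow p.xs t = p.flowTop p.B (t - p.timeToB p.xs) := by
  simp [flow, flowMid, h.xs_lt_B, not_lt.2 ht]

theorem le_flow_xs (h : p.Admissible) {t : ℝ} (ht : p.timeToB p.xs ≤ t) :
    p.B ≤ p.flow p.xs t := by
  rw [flow_xs_of_ge h ht, flowTop]
  have : 1 ≤ Real.exp (p.r * (t - p.timeToB p.xs)) :=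
    Real.one_le_exp (mul_nonneg h.r_pos.le (by linarith))
  nlinarith [h.xs_lt_B]

theorem mid_ne (h : p.Admissible) {y : ℝ} (h1 : p.xs ≤ y) (h2 : y ≤ p.B) : y + p.xss ≠ 0 :=
  fun h0 => by simpa [h0] using mid_pos h h1 h2

theorem flow_xs_lt (h : p.Admissible) {t : ℝ} (ht : t < p.timeToB p.xs) :
    p.flow p.xs t < p.B := by
  have hk := sub_ne_zero.2 h.r_ne_cT
  have a := mid_pos h le_rfl h.xs_lt_B.le
  have hE := exp_timeToB h le_rfl h.xs_lt_B
  rw [flow_xs_of_lt h ht]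
  -- By `mid_pos`, `x* + x**` has the sign of `r - c_T`, so the exponential formula increases in `t`
  -- in both cases.
  rcases lt_or_gt_of_ne hk with hk | hk
  · have a' : p.xs + p.xss < 0 := by nlinarith
    have e2 : Real.exp ((p.r - p.cT) * p.timeToB p.xs) < Real.exp ((p.r - p.cT) * t) :=
      Real.exp_lt_exp.2 (by nlinarith)
    nlinarith
  · have a' : 0 < p.xs + p.xss := by nlinarith
    have e2 : Real.exp ((p.r - p.cT) * t) < Real.exp ((p.r - p.cT) * p.timeToB p.xs) :=
      Real.exp_lt_exp.2 (by nlinarith)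
    nlinarith

/-- The semigroup property of the growth, along the trajectory of `x*`. -/
theorem flow_flow_xs (h : p.Admissible) {t s : ℝ} (ht : 0 ≤ t) (hs : 0 ≤ s) :
    p.flow (p.flow p.xs t) s = p.flow p.xs (t + s) := by
  rcases lt_or_ge t (p.timeToB p.xs) with hT | hT
  · have h1 := le_flow h le_rfl ht
    have h2 := flow_xs_lt h hT
    have hk := sub_ne_zero.2 h.r_ne_cT
    have hB := mid_ne h h.xs_lt_B.le le_rfl
    have hX := mid_ne h le_rfl h.xs_lt_B.le
    have hsum : p.flow p.xs t + p.xss = (p.xs + p.xss) * Real.exp ((p.r - p.cT) * t) := by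
      rw [flow_xs_of_lt h hT]; ring
    -- Travel times add up along the trajectory, so both sides of the semigroup identity change
    -- formula at the same instant.
    have htime : p.timeToB (p.flow p.xs t) = p.timeToB p.xs - t := by
      unfold timeToB
      rw [hsum, ← div_div, Real.log_div (div_ne_zero hB hX) (Real.exp_pos _).ne', Real.log_exp,
        sub_div, mul_div_cancel_left₀ _ hk]
    rw [flow, if_neg (not_le.2 h2), if_pos h1, flowMid, htime]
    rcases lt_or_ge (t + s) (p.timeToB p.xs) with hts | hts
    · rw [if_pos (by linarith), flow_xs_of_lt h hts, hsum, mul_assoc, ← Real.exp_add, mul_add]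
    · rw [if_neg (by linarith), flow_xs_of_ge h hts]
      congr 1
      ring
  · rw [flow, if_pos (le_flow_xs h hT), flow_xs_of_ge h hT, flow_xs_of_ge h (by linarith)]
    unfold flowTop
    have : p.r * (t + s - p.timeToB p.xs) = p.r * (t - p.timeToB p.xs) + p.r * s := by ring
    rw [this, Real.exp_add]
    ring

/-- The time the growth needs from `x*` to `u`, for `u ∈ [x*, B]`. -/
noncomputable def hitMid (p : CapitalParams) (u : ℝ) : ℝ :=
  Real.log ((u + p.xss) / (p.xs + p.xss)) / (p.r - p.cT)

/-- The time the growth needs from `x*` to `u`, for `u ≥ B`. -/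
noncomputable def hitTop (p : CapitalParams) (u : ℝ) : ℝ :=
  p.timeToB p.xs + Real.log ((u - p.xs) / (p.B - p.xs)) / p.r

/-- The time the growth needs from `x*` to `u ≥ x*`. -/
noncomputable def hit (p : CapitalParams) (u : ℝ) : ℝ := if u ≤ p.B then p.hitMid u else p.hitTop u

theorem hitMid_B (p : CapitalParams) : p.hitMid p.B = p.timeToB p.xs := rfl

theorem hitTop_B (h : p.Admissible) : p.hitTop p.B = p.timeToB p.xs := by
  simp [hitTop, div_self (sub_ne_zero.2 h.xs_lt_B.ne')]

theorem hitMid_ratio_pos (h : p.Admissible) {u : ℝ} (h1 : p.xs ≤ u) (h2 : u ≤ p.B) :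
    0 < (u + p.xss) / (p.xs + p.xss) := by
  have := div_pos (mid_pos h h1 h2) (mid_pos h le_rfl h.xs_lt_B.le)
  rwa [mul_div_mul_left _ _ (sub_ne_zero.2 h.r_ne_cT)] at this

/-- The denominator is the drift at `u`, by `mid_eq`: a hitting time has derivative one over the
speed. -/
theorem hasDerivAt_hitMid (h : p.Admissible) {u : ℝ} (h1 : p.xs ≤ u) (h2 : u ≤ p.B) :
    HasDerivAt p.hitMid ((p.r - p.cT) * (u + p.xss))⁻¹ u := by
  have hk := sub_ne_zero.2 h.r_ne_cT
  have hX := mid_ne h le_rfl h.xs_lt_B.le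
  have hu := mid_ne h h1 h2
  have := ((((hasDerivAt_id u).add_const p.xss).div_const (p.xs + p.xss)).log
    (hitMid_ratio_pos h h1 h2).ne').div_const (p.r - p.cT)
  refine this.congr_deriv ?_
  simp only [id]
  field_simp

theorem hasDerivAt_hitTop (h : p.Admissible) {u : ℝ} (h1 : p.B ≤ u) :
    HasDerivAt p.hitTop (p.r * (u - p.xs))⁻¹ u := by
  have hB := h.xs_lt_B
  have hr := h.r_pos.ne'
  have hX : p.B - p.xs ≠ 0 := by linarith
  have hu : u - p.xs ≠ 0 := by linarith
  have := (((((hasDerivAt_id u).sub_const p.xs).div_const (p.B - p.xs)).log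
    (div_ne_zero hu hX)).div_const p.r).const_add (p.timeToB p.xs)
  refine this.congr_deriv ?_
  simp only [id]
  field_simp

theorem hit_of_le {u : ℝ} (hu : u ≤ p.B) : p.hit u = p.hitMid u := if_pos hu

theorem hit_of_ge (h : p.Admissible) {u : ℝ} (hu : p.B ≤ u) : p.hit u = p.hitTop u := by
  rcases eq_or_lt_of_le hu with rfl | hu
  · rw [hit_of_le le_rfl, hitMid_B, hitTop_B h]
  · exact if_neg (not_le.2 hu)

theorem continuousOn_hit (h : p.Admissible) : ContinuousOn p.hit (Ici p.xs) := by
  have h1 : ContinuousOn p.hit (Icc p.xs p.B) :=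
    ContinuousOn.congr (fun u hu => (hasDerivAt_hitMid h hu.1 hu.2).continuousAt.continuousWithinAt)
      fun u hu => hit_of_le hu.2
  have h2 : ContinuousOn p.hit (Ici p.B) :=
    ContinuousOn.congr (fun u hu => (hasDerivAt_hitTop h hu).continuousAt.continuousWithinAt)
      fun u hu => hit_of_ge h hu
  rw [← Icc_union_Ici_eq_Ici h.xs_lt_B.le]
  exact h1.union_of_isClosed h2 isClosed_Icc isClosed_Ici

theorem timeToB_le_hit (h : p.Admissible) {u : ℝ} (hu : p.B ≤ u) : p.timeToB p.xs ≤ p.hit u := by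
  rw [hit_of_ge h hu, hitTop]
  have hB := h.xs_lt_B
  have : 0 ≤ Real.log ((u - p.xs) / (p.B - p.xs)) / p.r := by
    refine div_nonneg (Real.log_nonneg ?_) h.r_pos.le
    rw [le_div_iff₀ (by linarith)]
    linarith
  linarith

theorem hit_eq_sub (h : p.Admissible) {u : ℝ} (h1 : p.xs ≤ u) (h2 : u < p.B) :
    p.hit u = p.timeToB p.xs - p.timeToB u := by
  have hB := mid_ne h h.xs_lt_B.le le_rfl
  have hX := mid_ne h le_rfl h.xs_lt_B.le
  have hu := mid_ne h h1 h2.le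
  rw [hit_of_le h2.le, hitMid, timeToB, timeToB, Real.log_div hu hX, Real.log_div hB hX,
    Real.log_div hB hu]
  ring

theorem hit_lt (h : p.Admissible) {u : ℝ} (h1 : p.xs ≤ u) (h2 : u < p.B) :
    p.hit u < p.timeToB p.xs := by
  linarith [hit_eq_sub h h1 h2, timeToB_pos h h1 h2]

/-- Each level `u ≥ x*` is reached from `x*`, so a statement about `m` on `[x*, ∞)` can be pulled
back to one about time. -/
theorem flow_hit (h : p.Admissible) {u : ℝ} (h1 : p.xs ≤ u) : p.flow p.xs (p.hit u) = u := by
  rcases lt_or_ge u p.B with h2 | h2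
  · have hX := mid_ne h le_rfl h.xs_lt_B.le
    rw [flow_xs_of_lt h (hit_lt h h1 h2), hit_of_le h2.le, hitMid,
      mul_div_cancel₀ _ (sub_ne_zero.2 h.r_ne_cT), Real.exp_log (hitMid_ratio_pos h h1 h2.le),
      mul_div_cancel₀ _ hX]
    ring
  · have hB := h.xs_lt_B
    rw [flow_xs_of_ge h (timeToB_le_hit h h2), hit_of_ge h h2, hitTop, add_sub_cancel_left, flowTop,
      mul_div_cancel₀ _ h.r_pos.ne', Real.exp_log (div_pos (by linarith) (by linarith)),
      mul_div_cancel₀ _ (by linarith)]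
    ring

theorem hit_nonneg (h : p.Admissible) {u : ℝ} (h1 : p.xs ≤ u) : 0 ≤ p.hit u := by
  rcases lt_or_ge u p.B with h2 | h2
  · rw [hit_of_le h2.le, hitMid]
    have hmono := mid_pos h le_rfl h.xs_lt_B.le
    rcases lt_or_gt_of_ne (sub_ne_zero.2 h.r_ne_cT) with hk | hk
    · have a : p.xs + p.xss < 0 := by nlinarith
      refine div_nonneg_of_nonpos (Real.log_nonpos (hitMid_ratio_pos h h1 h2.le).le ?_) hk.le
      rw [div_le_one_of_neg a]
      linarith
    · have a : 0 < p.xs + p.xss := by nlinarith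
      refine div_nonneg (Real.log_nonneg ?_) hk.le
      rw [le_div_iff₀ a]
      linarith
  · exact (timeToB_pos h le_rfl h.xs_lt_B).le.trans (timeToB_le_hit h h2)

end CapitalParams

namespace CapitalParams

variable {p : CapitalParams}

/-! ### The trajectories -/

theorem lossTime_succ (W : ℕ → ℝ) (n : ℕ) : lossTime W (n + 1) = lossTime W n + W n :=
  Finset.sum_range_succ _ _

theorem lossTime_succ' (W : ℕ → ℝ) (n : ℕ) :
    lossTime W (n + 1) = W 0 + lossTime (fun i => W (i + 1)) n := by
  rw [lossTime, Finset.sum_range_succ', add_comm]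
  rfl

theorem strictMono_lossTime {W : ℕ → ℝ} (hW : ∀ i, 0 < W i) : StrictMono (lossTime W) :=
  strictMono_nat_of_lt_succ fun n => by rw [lossTime_succ]; linarith [hW n]

theorem lossCount_eq {W : ℕ → ℝ} (hW : ∀ i, 0 < W i) {N : ℕ} {t : ℝ} (h1 : lossTime W N ≤ t)
    (h2 : t < lossTime W (N + 1)) : lossCount W t = N := by
  have hmono := strictMono_lossTime hW
  have : {n : ℕ | lossTime W (n + 1) ≤ t} = Iio N := by
    ext n
    simp only [mem_ofPred_eq, mem_Iio]
    refine ⟨fun h => ?_, fun h => (hmono.monotone h).trans h1⟩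
    have := hmono.lt_iff_lt.1 (h.trans_lt h2)
    omega
  rw [lossCount, this, ← Finset.coe_Iio, ncard_coe_finset, Nat.card_Iio]

theorem capital_eq {W Z : ℕ → ℝ} {x : ℝ} (hW : ∀ i, 0 < W i) {N : ℕ} {t : ℝ}
    (h1 : lossTime W N ≤ t) (h2 : t < lossTime W (N + 1)) :
    p.capital W Z x t = p.flow (p.afterLoss W Z x N) (t - lossTime W N) := by
  rw [capital, lossCount_eq hW h1 h2]

/-- Either `t` lies between two consecutive losses, or all losses occur before `t`. -/
theorem capital_cases {W Z : ℕ → ℝ} {x : ℝ} (hW : ∀ i, 0 < W i) {t : ℝ} (ht : 0 ≤ t) :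
    (∃ N, lossTime W N ≤ t ∧ t < lossTime W (N + 1) ∧
      p.capital W Z x t = p.flow (p.afterLoss W Z x N) (t - lossTime W N)) ∨
    ((∀ n, lossTime W n ≤ t) ∧ p.capital W Z x t = p.flow x t) := by
  classical
  by_cases hex : ∃ n, t < lossTime W (n + 1)
  · left
    have h2 := Nat.find_spec hex
    have h1 : lossTime W (Nat.find hex) ≤ t := by
      rcases hN : Nat.find hex with _ | m
      · simpa [lossTime] using ht
      · exact not_lt.1 (Nat.find_min hex (m := m) (by omega))
    exact ⟨_, h1, h2, capital_eq hW h1 h2⟩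
  · right
    push Not at hex
    refine ⟨fun n => ((strictMono_lossTime hW).monotone (Nat.le_succ n)).trans (hex n), ?_⟩
    have : {n : ℕ | lossTime W (n + 1) ≤ t} = univ := by ext n; simp [hex n]
    -- `ncard` of an infinite set is `0`, so after an accumulation of losses the definition yields
    -- growth from `x` without losses. Such times do no harm, as this growth stays above `x*`.
    rw [capital, lossCount, this, Set.infinite_univ.ncard]
    simp [afterLoss, lossTime]

/-- The capital falls below `x*` for the first time at the loss number `n + 1`. -/
def TrappedAt (p : CapitalParams) (W Z : ℕ → ℝ) (x : ℝ) (n : ℕ) : Prop :=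
  (∀ k ≤ n, p.xs ≤ p.afterLoss W Z x k) ∧ p.afterLoss W Z x (n + 1) < p.xs

theorem TrappedAt.unique {W Z : ℕ → ℝ} {x : ℝ} {n m : ℕ} (hn : p.TrappedAt W Z x n)
    (hm : p.TrappedAt W Z x m) : n = m := by
  rcases lt_trichotomy n m with h | h | h
  · exact absurd (hm.1 (n + 1) h) (not_le.2 hn.2)
  · exact h
  · exact absurd (hn.1 (m + 1) h) (not_le.2 hm.2)

theorem trappedAt_or {W Z : ℕ → ℝ} {x : ℝ} (hx : p.xs ≤ x) :
    (∃ n, p.TrappedAt W Z x n) ∨ ∀ n, p.xs ≤ p.afterLoss W Z x n := by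
  classical
  by_cases hex : ∃ n, p.afterLoss W Z x n < p.xs
  · left
    have h1 := Nat.find_spec hex
    rcases hN : Nat.find hex with _ | m
    · rw [hN] at h1
      exact absurd hx (not_le.2 h1)
    · rw [hN] at h1
      exact ⟨m, fun k hk => not_lt.1 (Nat.find_min hex (by omega)), h1⟩
  · right
    push Not at hex
    exact hex

/-- Growth from a level at least `x*` never goes below `x*`, so the capital can become poor only at
a loss. -/
theorem discountedPenalty_of_not_trapped (h : p.Admissible) (w : ℝ → ℝ → ℝ) (δ : ℝ) {W Z : ℕ → ℝ}
    {x : ℝ} (hW : ∀ i, 0 < W i) (hA : ∀ n, p.xs ≤ p.afterLoss W Z x n) :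
    p.discountedPenalty w δ W Z x = 0 := by
  rw [discountedPenalty, if_neg]
  rintro ⟨t, ht0, ht⟩
  rcases capital_cases (p := p) (Z := Z) (x := x) hW ht0 with ⟨N, h1, -, h3⟩ | ⟨-, h3⟩
  · exact absurd (le_flow h (hA N) (sub_nonneg.2 h1)) (not_le.2 (h3 ▸ ht))
  · exact absurd (le_flow h (hA 0) ht0) (not_le.2 (h3 ▸ ht))

/-- The discounted penalty when the capital is trapped at the loss number `n + 1`. -/
noncomputable def penaltyAt (p : CapitalParams) (w : ℝ → ℝ → ℝ) (δ : ℝ) (W Z : ℕ → ℝ) (x : ℝ)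
    (n : ℕ) : ℝ :=
  w (p.flow (p.afterLoss W Z x n) (W n) - p.xs) (p.xs - p.afterLoss W Z x (n + 1))
    * Real.exp (-δ * lossTime W (n + 1))

theorem discountedPenalty_of_trappedAt (h : p.Admissible) (w : ℝ → ℝ → ℝ) (δ : ℝ) {W Z : ℕ → ℝ}
    {x : ℝ} (hW : ∀ i, 0 < W i) {n : ℕ} (hn : p.TrappedAt W Z x n) :
    p.discountedPenalty w δ W Z x = p.penaltyAt w δ W Z x n := by
  have hmono := strictMono_lossTime hW
  have h0 : ∀ k, 0 ≤ lossTime W k := fun k => by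
    have := hmono.monotone (Nat.zero_le k)
    simpa [lossTime] using this
  have hcap : p.capital W Z x (lossTime W (n + 1)) = p.afterLoss W Z x (n + 1) := by
    rw [capital_eq hW le_rfl (hmono (Nat.lt_succ_self _)), sub_self, flow_zero h]
  -- The infimum is attained: earlier times belong to growth phases that start at or above `x*`.
  have hleast : IsLeast (p.poorTimes W Z x) (lossTime W (n + 1)) := by
    refine ⟨⟨h0 _, hcap ▸ hn.2⟩, ?_⟩
    rintro t ⟨ht0, ht⟩
    by_contra hlt
    rw [not_le] at hlt
    rcases capital_cases (p := p) (Z := Z) (x := x) hW ht0 with ⟨N, h1, -, h3⟩ | ⟨h1, -⟩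
    · have hN : N < n + 1 := hmono.lt_iff_lt.1 (h1.trans_lt hlt)
      exact absurd (le_flow h (hn.1 N (by omega)) (sub_nonneg.2 h1)) (not_le.2 (h3 ▸ ht))
    · exact absurd (h1 (n + 1)) (not_le.2 hlt)
  have hτ : p.trappingTime W Z x = lossTime W (n + 1) := hleast.csInf_eq
  -- Just before the trapping loss the capital follows the continuous growth after loss `n`, so the
  -- left limit is the growth evaluated at the full waiting time.
  have hlim : Function.leftLim (p.capital W Z x) (lossTime W (n + 1))
      = p.flow (p.afterLoss W Z x n) (W n) := by
    refine leftLim_eq_of_tendsto ?_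
    have hcont : ContinuousWithinAt (fun t => p.flow (p.afterLoss W Z x n) (t - lossTime W n))
        (Ici (lossTime W n)) (lossTime W (n + 1)) := by
      refine ContinuousWithinAt.comp (t := Ici 0) (g := p.flow (p.afterLoss W Z x n))
        (f := fun t => t - lossTime W n) ?_ (by fun_prop) fun t ht => ?_
      · exact continuousOn_flow h _ _ (mem_Ici.2 (sub_nonneg.2 (hmono (Nat.lt_succ_self _)).le))
      · exact mem_Ici.2 (sub_nonneg.2 ht)
    have hlim := (hcont.continuousAt (Ici_mem_nhds (hmono (Nat.lt_succ_self n)))).tendsto.mono_left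
      (nhdsWithin_le_nhds (s := Iio (lossTime W (n + 1))))
    have hd : lossTime W (n + 1) - lossTime W n = W n := by rw [lossTime_succ]; ring
    simp only [hd] at hlim
    refine hlim.congr' ?_
    filter_upwards [Ico_mem_nhdsLT (hmono (Nat.lt_succ_self n))] with t ht
    exact (capital_eq hW ht.1 ht.2).symm
  rw [discountedPenalty, if_pos ⟨_, hleast.1⟩, hτ, hlim, hcap, penaltyAt,
    abs_of_neg (sub_neg.2 hn.2), neg_sub]

theorem zero_le_penaltyAt (h : p.Admissible) {w : ℝ → ℝ → ℝ}
    (hw0 : ∀ x₁ x₂, 0 ≤ x₁ → 0 < x₂ → x₂ ≤ p.xs → 0 ≤ w x₁ x₂) (δ : ℝ) {W Z : ℕ → ℝ}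
    {x : ℝ} (hW : ∀ i, 0 < W i) (hZ : ∀ i, 0 ≤ Z i) {n : ℕ} (hn : p.TrappedAt W Z x n) :
    0 ≤ p.penaltyAt w δ W Z x n := by
  have h1 := le_flow h (hn.1 n le_rfl) (hW n).le
  have h2 : 0 ≤ p.afterLoss W Z x (n + 1) := mul_nonneg (hZ n) (h.xs_pos.le.trans h1)
  exact mul_nonneg (hw0 _ _ (by linarith) (by linarith [hn.2]) (by linarith)) (Real.exp_pos _).le

theorem penaltyAt_le (h : p.Admissible) {w : ℝ → ℝ → ℝ} {C : ℝ}
    (hC : ∀ x₁ x₂, 0 ≤ x₁ → 0 < x₂ → x₂ ≤ p.xs → w x₁ x₂ ≤ C) (δ : ℝ) {W Z : ℕ → ℝ}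
    {x : ℝ} (hW : ∀ i, 0 < W i) (hZ : ∀ i, 0 ≤ Z i) {n : ℕ} (hn : p.TrappedAt W Z x n) :
    p.penaltyAt w δ W Z x n ≤ C * Real.exp (-δ * lossTime W (n + 1)) := by
  have h1 := le_flow h (hn.1 n le_rfl) (hW n).le
  have h2 : 0 ≤ p.afterLoss W Z x (n + 1) := mul_nonneg (hZ n) (h.xs_pos.le.trans h1)
  exact mul_le_mul_of_nonneg_right (hC _ _ (by linarith) (by linarith [hn.2]) (by linarith))
    (Real.exp_pos _).le

theorem discountedPenalty_nonneg (h : p.Admissible) {w : ℝ → ℝ → ℝ}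
    (hw0 : ∀ x₁ x₂, 0 ≤ x₁ → 0 < x₂ → x₂ ≤ p.xs → 0 ≤ w x₁ x₂) (δ : ℝ) {W Z : ℕ → ℝ}
    {x : ℝ} (hx : p.xs ≤ x) (hW : ∀ i, 0 < W i) (hZ : ∀ i, 0 ≤ Z i) :
    0 ≤ p.discountedPenalty w δ W Z x := by
  rcases trappedAt_or (p := p) (W := W) (Z := Z) hx with ⟨n, hn⟩ | hA
  · rw [discountedPenalty_of_trappedAt h w δ hW hn]
    exact zero_le_penaltyAt h hw0 δ hW hZ hn
  · rw [discountedPenalty_of_not_trapped h w δ hW hA]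

/-! ### The first-loss decomposition along a trajectory -/

open Classical in
/-- The discounted penalty in `[0, ∞]`, as a sum over the number of the trapping loss. -/
noncomputable def penaltySum (p : CapitalParams) (w : ℝ → ℝ → ℝ) (δ : ℝ) (W Z : ℕ → ℝ) (x : ℝ) :
    ENNReal :=
  ∑' n, if p.TrappedAt W Z x n then ENNReal.ofReal (p.penaltyAt w δ W Z x n) else 0

/-- At most one term of the series is nonzero. The series replaces the infimum and left limit by
expressions that are visibly measurable in `W`, `Z` and `x`. -/
theorem ofReal_discountedPenalty (h : p.Admissible) (w : ℝ → ℝ → ℝ) (δ : ℝ) {W Z : ℕ → ℝ} {x : ℝ}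
    (hx : p.xs ≤ x) (hW : ∀ i, 0 < W i) :
    ENNReal.ofReal (p.discountedPenalty w δ W Z x) = p.penaltySum w δ W Z x := by
  unfold penaltySum
  rcases trappedAt_or (p := p) (W := W) (Z := Z) hx with ⟨n, hn⟩ | hA
  · rw [discountedPenalty_of_trappedAt h w δ hW hn, tsum_eq_single n, if_pos hn]
    intro m hm
    rw [if_neg fun h' => hm (h'.unique hn)]
  · rw [discountedPenalty_of_not_trapped h w δ hW hA]
    simp [TrappedAt, fun n => not_lt.2 (hA n)]

theorem afterLoss_succ' (W Z : ℕ → ℝ) (x : ℝ) (n : ℕ) :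
    p.afterLoss W Z x (n + 1) = p.afterLoss (fun i => W (i + 1)) (fun i => Z (i + 1))
      (Z 0 * p.flow x (W 0)) n := by
  induction n with
  | zero => rfl
  | succ n ih => rw [afterLoss, ih]; rfl

/-- This and `trappedAt_succ` are the pathwise restart: after a first loss that does not trap, the
shifted input drives the same process, discounted by the first waiting time. -/
theorem penaltyAt_succ (w : ℝ → ℝ → ℝ) (δ : ℝ) (W Z : ℕ → ℝ) (x : ℝ) (n : ℕ) :
    p.penaltyAt w δ W Z x (n + 1) = Real.exp (-δ * W 0)
      * p.penaltyAt w δ (fun i => W (i + 1)) (fun i => Z (i + 1)) (Z 0 * p.flow x (W 0)) n := by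
  rw [penaltyAt, penaltyAt, afterLoss_succ', afterLoss_succ', lossTime_succ', mul_add, Real.exp_add]
  ring

theorem trappedAt_succ {W Z : ℕ → ℝ} {x : ℝ} (hx : p.xs ≤ x) (n : ℕ) :
    p.TrappedAt W Z x (n + 1) ↔
      p.TrappedAt (fun i => W (i + 1)) (fun i => Z (i + 1)) (Z 0 * p.flow x (W 0)) n := by
  unfold TrappedAt
  rw [afterLoss_succ']
  refine and_congr_left fun _ => ⟨fun h k hk => ?_, fun h k hk => ?_⟩
  · rw [← afterLoss_succ']
    exact h (k + 1) (by omega)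
  · rcases k with _ | k
    · exact hx
    · rw [afterLoss_succ']
      exact h k (by omega)

/-- Conditioning on the first loss: either it traps the capital, or the process starts afresh. -/
theorem penaltySum_eq (w : ℝ → ℝ → ℝ) (δ : ℝ) {W Z : ℕ → ℝ} {x : ℝ} (hx : p.xs ≤ x) :
    p.penaltySum w δ W Z x = ENNReal.ofReal (Real.exp (-δ * W 0)) *
      if Z 0 * p.flow x (W 0) < p.xs then
        ENNReal.ofReal (w (p.flow x (W 0) - p.xs) (p.xs - Z 0 * p.flow x (W 0)))
      else p.penaltySum w δ (fun i => W (i + 1)) (fun i => Z (i + 1)) (Z 0 * p.flow x (W 0)) := by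
  have h0 : p.TrappedAt W Z x 0 ↔ Z 0 * p.flow x (W 0) < p.xs := by
    simp [TrappedAt, afterLoss, hx]
  rw [penaltySum, tsum_eq_zero_add' ENNReal.summable]
  by_cases h1 : Z 0 * p.flow x (W 0) < p.xs
  · rw [if_pos h1, if_pos (h0.2 h1)]
    have : ∀ n, ¬ p.TrappedAt W Z x (n + 1) := fun n h => absurd (h.unique (h0.2 h1)) (by omega)
    simp only [this, if_false, tsum_zero, add_zero]
    rw [penaltyAt, mul_comm, ENNReal.ofReal_mul (Real.exp_pos _).le]
    simp [lossTime, afterLoss]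
  · rw [if_neg h1, if_neg (fun h => h1 (h0.1 h)), zero_add, penaltySum, ← ENNReal.tsum_mul_left]
    refine tsum_congr fun n => ?_
    rw [penaltyAt_succ, ENNReal.ofReal_mul (Real.exp_pos _).le, mul_ite, mul_zero]
    congr 1
    exact propext (trappedAt_succ hx n)

theorem measurable_afterLoss {α : Type*} [MeasurableSpace α] {W Z : α → ℕ → ℝ} {x : α → ℝ}
    (hW : Measurable W) (hZ : Measurable Z) (hx : Measurable x) (n : ℕ) :
    Measurable fun a => p.afterLoss (W a) (Z a) (x a) n := by
  induction n with
  | zero => exact hx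
  | succ n ih =>
    exact (measurable_pi_iff.1 hZ n).mul (Measurable.flow ih (measurable_pi_iff.1 hW n))

theorem measurable_penaltySum {α : Type*} [MeasurableSpace α] {w : ℝ → ℝ → ℝ}
    (hw : Measurable (Function.uncurry w)) (δ : ℝ) {W Z : α → ℕ → ℝ} {x : α → ℝ}
    (hW : Measurable W) (hZ : Measurable Z) (hx : Measurable x) :
    Measurable fun a => p.penaltySum w δ (W a) (Z a) (x a) := by
  have hA := fun n => measurable_afterLoss (p := p) hW hZ hx n
  have hWn := fun n => measurable_pi_iff.1 hW n
  refine Measurable.tsum fun n => Measurable.ite ?_ ?_ measurable_const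
  · have : {a | p.TrappedAt (W a) (Z a) (x a) n} =
        (⋂ k, ⋂ (_ : k ≤ n), {a | p.xs ≤ p.afterLoss (W a) (Z a) (x a) k}) ∩
          {a | p.afterLoss (W a) (Z a) (x a) (n + 1) < p.xs} := by
      ext a
      simp [TrappedAt]
    rw [this]
    exact (MeasurableSet.iInter fun k => MeasurableSet.iInter fun _ =>
      measurableSet_le measurable_const (hA k)).inter (measurableSet_lt (hA _) measurable_const)
  · unfold penaltyAt lossTime
    refine (Measurable.mul ?_ ?_).ennreal_ofReal
    · exact hw.comp (((Measurable.flow (hA n) (hWn n)).sub_const _).prodMk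
        ((hA (n + 1)).const_sub _))
    · exact ((Finset.measurable_sum _ fun i _ => hWn i).const_mul (-δ)).exp

end CapitalParams

/-! ### The random input -/

theorem ae_pos_expMeasure (lam : ℝ) : ∀ᵐ t ∂(expMeasure lam), 0 < t := by
  rw [expMeasure, gammaMeasure, ae_withDensity_iff (f := gammaPDF 1 lam)
    (measurable_gammaPDFReal 1 lam).ennreal_ofReal]
  have h0 : ∀ᵐ t : ℝ, t ≠ 0 := by simp [ae_iff]
  filter_upwards [h0] with t ht hne
  by_contra hneg
  exact hne (gammaPDF_of_neg (lt_of_le_of_ne (not_lt.1 hneg) ht))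

theorem lintegral_expMeasure (lam : ℝ) {f : ℝ → ENNReal} (hf : Measurable f) :
    ∫⁻ t, f t ∂(expMeasure lam)
      = ∫⁻ t in Ioi 0, ENNReal.ofReal (lam * Real.exp (-lam * t)) * f t := by
  rw [expMeasure, gammaMeasure, lintegral_withDensity_eq_lintegral_mul _ (f := gammaPDF 1 lam)
    (measurable_gammaPDFReal 1 lam).ennreal_ofReal hf, ← lintegral_indicator measurableSet_Ioi]
  refine lintegral_congr_ae ?_
  have h0 : ∀ᵐ t : ℝ, t ≠ 0 := by simp [ae_iff]
  filter_upwards [h0] with t ht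
  rcases lt_or_gt_of_ne ht with ht | ht
  · rw [indicator_of_notMem (by simp [ht.le]), Pi.mul_apply, gammaPDF_of_neg ht, zero_mul]
  · rw [indicator_of_mem (mem_Ioi.2 ht), Pi.mul_apply, neg_mul]
    congr 1
    exact exponentialPDF_of_nonneg ht.le

namespace IsLossInput

variable {Ω : Type*} [MeasurableSpace Ω] {P : Measure Ω} {lam : ℝ} {ν : Measure ℝ}
  {W Z : ℕ → Ω → ℝ}

theorem measurable_elim (h : IsLossInput P lam ν W Z) (i : ℕ ⊕ ℕ) :
    Measurable ((Sum.elim W Z : ℕ ⊕ ℕ → Ω → ℝ) i) := by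
  rcases i with i | i
  · exact h.measurable_wait i
  · exact h.measurable_prop i

/-- The two vectors are measurable with respect to the σ-algebras of disjoint blocks of indices in
`ℕ ⊕ ℕ`. -/
theorem indepFun_first_later (h : IsLossInput P lam ν W Z) :
    IndepFun (fun ω => (W 0 ω, Z 0 ω))
      (fun ω (i : ℕ ⊕ ℕ) => (Sum.elim W Z : ℕ ⊕ ℕ → Ω → ℝ) (Sum.map Nat.succ Nat.succ i) ω) P := by
  have hdisj : Disjoint ({Sum.inl 0, Sum.inr 0} : Set (ℕ ⊕ ℕ))
      (range (Sum.map Nat.succ Nat.succ)) := by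
    rw [Set.disjoint_left]
    rintro i hi ⟨j, rfl⟩
    rcases j with j | j <;> simp at hi
  have hind := indep_iSup_of_disjoint (fun i => (h.measurable_elim i).comap_le) h.indep hdisj
  have hle : ∀ {S : Set (ℕ ⊕ ℕ)} {i : ℕ ⊕ ℕ}, i ∈ S →
      @Measurable Ω ℝ (⨆ i ∈ S, MeasurableSpace.comap ((Sum.elim W Z : ℕ ⊕ ℕ → Ω → ℝ) i)
        inferInstance) _ ((Sum.elim W Z : ℕ ⊕ ℕ → Ω → ℝ) i) := fun {S i} hi =>
    measurable_iff_comap_le.2 (le_iSup₂ (f := fun i (_ : i ∈ S) =>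
      MeasurableSpace.comap ((Sum.elim W Z : ℕ ⊕ ℕ → Ω → ℝ) i) inferInstance) i hi)
  refine indep_of_indep_of_le_left (indep_of_indep_of_le_right hind ?_) ?_
  · refine measurable_iff_comap_le.1 ?_
    exact @measurable_pi_lambda _ _ _ (_) _ _ fun i => hle (mem_range_self i)
  · refine measurable_iff_comap_le.1 ?_
    exact Measurable.prodMk (hle (i := Sum.inl 0) (by simp)) (hle (i := Sum.inr 0) (by simp))

theorem map_first [IsProbabilityMeasure P] (h : IsLossInput P lam ν W Z) :
    P.map (fun ω => (W 0 ω, Z 0 ω)) = (expMeasure lam).prod ν := by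
  have hind : IndepFun (W 0) (Z 0) P := h.indep.indepFun (i := Sum.inl 0) (j := Sum.inr 0) (by simp)
  rw [hind.map_prod_eq_prod_map_map (h.measurable_wait 0).aemeasurable
    (h.measurable_prop 0).aemeasurable, h.law_wait, h.law_prop]

/-- By independence both laws are products of their marginals, and the shift preserves each
marginal. -/
theorem map_later [IsProbabilityMeasure P] (h : IsLossInput P lam ν W Z) :
    P.map (fun ω (i : ℕ ⊕ ℕ) => (Sum.elim W Z : ℕ ⊕ ℕ → Ω → ℝ) (Sum.map Nat.succ Nat.succ i) ω)
      = P.map (fun ω (i : ℕ ⊕ ℕ) => (Sum.elim W Z : ℕ ⊕ ℕ → Ω → ℝ) i ω) := by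
  have hinj : Function.Injective (Sum.map Nat.succ Nat.succ) :=
    Sum.map_injective.2 ⟨Nat.succ_injective, Nat.succ_injective⟩
  rw [h.indep.map_fun_eq_infinitePi_map h.measurable_elim,
    (h.indep.precomp hinj).map_fun_eq_infinitePi_map fun i => h.measurable_elim _]
  congr 1
  funext i
  rcases i with i | i
  · simp [h.law_wait]
  · simp [h.law_prop]

/-- The first loss is independent of the later ones, which are distributed as the whole input. -/
theorem lintegral_first [IsProbabilityMeasure P] [IsProbabilityMeasure ν]
    (h : IsLossInput P lam ν W Z) {f : ℝ → ℝ → (ℕ → ℝ) → (ℕ → ℝ) → ENNReal}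
    (hf : Measurable fun q : (ℝ × ℝ) × (ℕ → ℝ) × (ℕ → ℝ) => f q.1.1 q.1.2 q.2.1 q.2.2) :
    ∫⁻ ω, f (W 0 ω) (Z 0 ω) (fun i => W (i + 1) ω) (fun i => Z (i + 1) ω) ∂P
      = ∫⁻ t, ∫⁻ z, ∫⁻ ω, f t z (fun i => W i ω) (fun i => Z i ω) ∂P ∂ν ∂(expMeasure lam) := by
  have hlaw : IsProbabilityMeasure (expMeasure lam) := by
    rw [← h.law_wait 0]
    exact Measure.isProbabilityMeasure_map (h.measurable_wait 0).aemeasurable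
  let split : (ℕ ⊕ ℕ → ℝ) → (ℕ → ℝ) × (ℕ → ℝ) := fun y =>
    (fun i => y (Sum.inl i), fun i => y (Sum.inr i))
  have hsplit : Measurable split := by fun_prop
  have hfst : Measurable (fun ω => (W 0 ω, Z 0 ω)) :=
    (h.measurable_wait 0).prodMk (h.measurable_prop 0)
  have hlat : Measurable (fun ω (i : ℕ ⊕ ℕ) =>
      (Sum.elim W Z : ℕ ⊕ ℕ → Ω → ℝ) (Sum.map Nat.succ Nat.succ i) ω) :=
    measurable_pi_lambda _ fun i => h.measurable_elim _
  have hall : Measurable (fun ω (i : ℕ ⊕ ℕ) => (Sum.elim W Z : ℕ ⊕ ℕ → Ω → ℝ) i ω) :=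
    measurable_pi_lambda _ fun i => h.measurable_elim _
  have hf' : Measurable fun q : (ℝ × ℝ) × (ℕ ⊕ ℕ → ℝ) =>
      f q.1.1 q.1.2 (split q.2).1 (split q.2).2 :=
    hf.comp (measurable_fst.prodMk (hsplit.comp measurable_snd))
  have hprod := h.indepFun_first_later.map_prod_eq_prod_map_map hfst.aemeasurable hlat.aemeasurable
  have : IsProbabilityMeasure
      (P.map (fun ω (i : ℕ ⊕ ℕ) => (Sum.elim W Z : ℕ ⊕ ℕ → Ω → ℝ) i ω)) :=
    Measure.isProbabilityMeasure_map hall.aemeasurable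
  have h1 : ∫⁻ ω, f (W 0 ω) (Z 0 ω) (fun i => W (i + 1) ω) (fun i => Z (i + 1) ω) ∂P
      = ∫⁻ q, f q.1.1 q.1.2 (split q.2).1 (split q.2).2 ∂(P.map fun ω => ((W 0 ω, Z 0 ω),
        fun (i : ℕ ⊕ ℕ) => (Sum.elim W Z : ℕ ⊕ ℕ → Ω → ℝ) (Sum.map Nat.succ Nat.succ i) ω)) := by
    rw [lintegral_map hf' (hfst.prodMk hlat)]
    rfl
  rw [h1, hprod, h.map_first, h.map_later, lintegral_prod _ hf'.aemeasurable,
    lintegral_prod _ hf'.lintegral_prod_right'.aemeasurable]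
  refine lintegral_congr fun t => lintegral_congr fun z => ?_
  exact lintegral_map (f := fun y => f t z (split y).1 (split y).2)
    (hf'.comp (f := fun y => ((t, z), y)) (measurable_const.prodMk measurable_id)) hall

theorem ae_wait_pos (h : IsLossInput P lam ν W Z) : ∀ᵐ ω ∂P, ∀ i, 0 < W i ω := by
  rw [ae_all_iff]
  intro i
  have := ae_pos_expMeasure lam
  rw [← h.law_wait i] at this
  exact ae_of_ae_map (h.measurable_wait i).aemeasurable this

theorem ae_prop (h : IsLossInput P lam ν W Z) {q : ℝ → Prop} (hν : ∀ᵐ z ∂ν, q z) :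
    ∀ᵐ ω ∂P, ∀ i, q (Z i ω) := by
  rw [ae_all_iff]
  intro i
  rw [← h.law_prop i] at hν
  exact ae_of_ae_map (h.measurable_prop i).aemeasurable hν

end IsLossInput

/-! ### The expected penalty in `[0, ∞]` and its renewal equation. -/

namespace CapitalParams

variable {p : CapitalParams} {Ω : Type*} [MeasurableSpace Ω]

/-- The expected discounted penalty as an element of `[0, ∞]`. -/
noncomputable def meanPenalty (p : CapitalParams) (P : Measure Ω) (W Z : ℕ → Ω → ℝ)
    (w : ℝ → ℝ → ℝ) (δ x : ℝ) : ENNReal :=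
  ∫⁻ ω, p.penaltySum w δ (fun i => W i ω) (fun i => Z i ω) x ∂P

/-- The expected penalty, discounted to the time of a loss, given that the capital before this loss
is `u`. -/
noncomputable def meanAtLoss (p : CapitalParams) (P : Measure Ω) (W Z : ℕ → Ω → ℝ) (ν : Measure ℝ)
    (w : ℝ → ℝ → ℝ) (δ u : ℝ) : ENNReal :=
  ∫⁻ z, (if z * u < p.xs then ENNReal.ofReal (w (u - p.xs) (p.xs - z * u))
    else p.meanPenalty P W Z w δ (z * u)) ∂ν

variable {P : Measure Ω} {lam δ : ℝ} {ν : Measure ℝ} {W Z : ℕ → Ω → ℝ} {w : ℝ → ℝ → ℝ}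

theorem measurable_meanPenalty [SFinite P] (hWZ : IsLossInput P lam ν W Z)
    (hw : Measurable (Function.uncurry w)) : Measurable (p.meanPenalty P W Z w δ) := by
  have : Measurable fun q : ℝ × Ω =>
      p.penaltySum w δ (fun i => W i q.2) (fun i => Z i q.2) q.1 :=
    measurable_penaltySum hw δ
      (measurable_pi_lambda _ fun i => (hWZ.measurable_wait i).comp measurable_snd)
      (measurable_pi_lambda _ fun i => (hWZ.measurable_prop i).comp measurable_snd) measurable_fst
  exact this.lintegral_prod_right'

theorem measurable_loss_integrand [SFinite P] (hWZ : IsLossInput P lam ν W Z)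
    (hw : Measurable (Function.uncurry w)) :
    Measurable fun q : ℝ × ℝ => if q.2 * q.1 < p.xs then
      ENNReal.ofReal (w (q.1 - p.xs) (p.xs - q.2 * q.1))
      else p.meanPenalty P W Z w δ (q.2 * q.1) := by
  refine Measurable.ite (measurableSet_lt (by fun_prop) measurable_const) ?_
    ((measurable_meanPenalty hWZ hw).comp (by fun_prop))
  exact (hw.comp (f := fun q : ℝ × ℝ => (q.1 - p.xs, p.xs - q.2 * q.1))
    (by fun_prop)).ennreal_ofReal

theorem measurable_meanAtLoss [SFinite P] [SFinite ν] (hWZ : IsLossInput P lam ν W Z)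
    (hw : Measurable (Function.uncurry w)) : Measurable (p.meanAtLoss P W Z ν w δ) :=
  (measurable_loss_integrand hWZ hw).lintegral_prod_right'

/-- The renewal equation. -/
theorem meanPenalty_eq [IsProbabilityMeasure P] [IsProbabilityMeasure ν] (hlam : 0 ≤ lam)
    (hWZ : IsLossInput P lam ν W Z) (hw : Measurable (Function.uncurry w)) {x : ℝ}
    (hx : p.xs ≤ x) :
    p.meanPenalty P W Z w δ x = ∫⁻ t in Ioi 0, ENNReal.ofReal (lam * Real.exp (-(lam + δ) * t)) *
      p.meanAtLoss P W Z ν w δ (p.flow x t) := by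
  have hflow : Measurable fun t => p.flow x t := Measurable.flow measurable_const measurable_id
  have hsum : Measurable fun q : (ℝ × ℝ) × (ℕ → ℝ) × (ℕ → ℝ) =>
      ENNReal.ofReal (Real.exp (-δ * q.1.1)) *
      if q.1.2 * p.flow x q.1.1 < p.xs then
        ENNReal.ofReal (w (p.flow x q.1.1 - p.xs) (p.xs - q.1.2 * p.flow x q.1.1))
      else p.penaltySum w δ q.2.1 q.2.2 (q.1.2 * p.flow x q.1.1) := by
    have hfl : Measurable fun q : (ℝ × ℝ) × (ℕ → ℝ) × (ℕ → ℝ) => p.flow x q.1.1 :=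
      Measurable.flow measurable_const (by fun_prop)
    have hz : Measurable fun q : (ℝ × ℝ) × (ℕ → ℝ) × (ℕ → ℝ) => q.1.2 * p.flow x q.1.1 :=
      Measurable.mul (by fun_prop) hfl
    refine Measurable.mul (by fun_prop)
      (Measurable.ite (measurableSet_lt hz measurable_const) ?_ ?_)
    · exact (hw.comp ((hfl.sub_const _).prodMk (hz.const_sub _))).ennreal_ofReal
    · exact measurable_penaltySum hw δ (by fun_prop) (by fun_prop) hz
  have h1 : ∀ ω, p.penaltySum w δ (fun i => W i ω) (fun i => Z i ω) x = _ := fun ω =>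
    penaltySum_eq w δ (W := fun i => W i ω) (Z := fun i => Z i ω) hx
  simp only [meanPenalty, h1]
  rw [hWZ.lintegral_first (f := fun t z W Z => ENNReal.ofReal (Real.exp (-δ * t)) *
      if z * p.flow x t < p.xs then
        ENNReal.ofReal (w (p.flow x t - p.xs) (p.xs - z * p.flow x t))
      else p.penaltySum w δ W Z (z * p.flow x t)) hsum]
  have h2 : ∀ t z, ∫⁻ ω, ENNReal.ofReal (Real.exp (-δ * t)) *
      (if z * p.flow x t < p.xs then
        ENNReal.ofReal (w (p.flow x t - p.xs) (p.xs - z * p.flow x t))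
      else p.penaltySum w δ (fun i => W i ω) (fun i => Z i ω) (z * p.flow x t)) ∂P
      = ENNReal.ofReal (Real.exp (-δ * t)) * (if z * p.flow x t < p.xs then
        ENNReal.ofReal (w (p.flow x t - p.xs) (p.xs - z * p.flow x t))
        else p.meanPenalty P W Z w δ (z * p.flow x t)) := by
    -- In the trapping case the integrand does not depend on `ω`, and `P` has total mass one.
    intro t z
    rw [lintegral_const_mul' _ _ ENNReal.ofReal_ne_top]
    split_ifs
    · simp
    · rfl
  have h3 : ∀ t, ∫⁻ z, ENNReal.ofReal (Real.exp (-δ * t)) * (if z * p.flow x t < p.xs then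
        ENNReal.ofReal (w (p.flow x t - p.xs) (p.xs - z * p.flow x t))
        else p.meanPenalty P W Z w δ (z * p.flow x t)) ∂ν
      = ENNReal.ofReal (Real.exp (-δ * t)) * p.meanAtLoss P W Z ν w δ (p.flow x t) := fun t =>
    lintegral_const_mul' _ _ ENNReal.ofReal_ne_top
  simp only [h2, h3]
  rw [lintegral_expMeasure lam (f := fun t => ENNReal.ofReal (Real.exp (-δ * t)) *
    p.meanAtLoss P W Z ν w δ (p.flow x t))
    (Measurable.mul (by fun_prop) ((measurable_meanAtLoss hWZ hw).comp hflow))]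
  refine lintegral_congr fun t => ?_
  rw [← mul_assoc, ← ENNReal.ofReal_mul (mul_nonneg hlam (Real.exp_pos _).le), mul_assoc,
    ← Real.exp_add]
  congr 4
  ring

end CapitalParams

namespace CapitalParams

variable {p : CapitalParams} {Ω : Type*} [MeasurableSpace Ω]
  {P : Measure Ω} {lam δ : ℝ} {ν : Measure ℝ} {W Z : ℕ → Ω → ℝ} {w : ℝ → ℝ → ℝ}

/-! ### The renewal equation along the trajectory of `x*` -/

/-- The expected discounted penalty as a real number. -/
noncomputable def realPenalty (p : CapitalParams) (P : Measure Ω) (W Z : ℕ → Ω → ℝ)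
    (w : ℝ → ℝ → ℝ) (δ x : ℝ) : ℝ := (p.meanPenalty P W Z w δ x).toReal

theorem lintegral_discountedPenalty (hp : p.Admissible) (hWZ : IsLossInput P lam ν W Z) {x : ℝ}
    (hx : p.xs ≤ x) :
    ∫⁻ ω, ENNReal.ofReal (p.discountedPenalty w δ (fun i => W i ω) (fun i => Z i ω) x) ∂P
      = p.meanPenalty P W Z w δ x := by
  refine lintegral_congr_ae ?_
  filter_upwards [hWZ.ae_wait_pos] with ω hω
  exact ofReal_discountedPenalty hp w δ hx hω

theorem meanPenalty_ne_top (hp : p.Admissible) (hWZ : IsLossInput P lam ν W Z) {x : ℝ}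
    (hx : p.xs ≤ x) (hfin : Integrable
      (fun ω => p.discountedPenalty w δ (fun i => W i ω) (fun i => Z i ω) x) P) :
    p.meanPenalty P W Z w δ x ≠ ⊤ := by
  rw [← lintegral_discountedPenalty hp hWZ hx]
  exact hfin.lintegral_lt_top.ne

theorem expectedPenalty_eq (hp : p.Admissible) (hWZ : IsLossInput P lam ν W Z)
    (hν : ∀ᵐ z ∂ν, z ∈ Icc (0 : ℝ) 1)
    (hw0 : ∀ x₁ x₂, 0 ≤ x₁ → 0 < x₂ → x₂ ≤ p.xs → 0 ≤ w x₁ x₂) {x : ℝ}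
    (hx : p.xs ≤ x) (hfin : Integrable
      (fun ω => p.discountedPenalty w δ (fun i => W i ω) (fun i => Z i ω) x) P) :
    p.expectedPenalty P W Z w δ x = p.realPenalty P W Z w δ x := by
  rw [expectedPenalty, integral_eq_lintegral_of_nonneg_ae _ hfin.1,
    lintegral_discountedPenalty hp hWZ hx, realPenalty]
  filter_upwards [hWZ.ae_wait_pos, hWZ.ae_prop hν] with ω h1 h2
  exact discountedPenalty_nonneg hp hw0 δ hx h1 fun i => (h2 i).1

/-- The trajectory from `φ(x*,t)` is the trajectory from `x*` delayed by `t`; the substitution `s ↦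
t + s` moves the dependence on `t` out of the integrand, about which no regularity is known yet. -/
theorem meanPenalty_flow_xs [IsProbabilityMeasure P] [IsProbabilityMeasure ν]
    (hp : p.Admissible) (hlam : 0 ≤ lam) (hWZ : IsLossInput P lam ν W Z)
    (hw : Measurable (Function.uncurry w)) {t : ℝ} (ht : 0 ≤ t) :
    p.meanPenalty P W Z w δ (p.flow p.xs t) = ENNReal.ofReal (Real.exp ((lam + δ) * t)) *
      ∫⁻ s in Ioi t, ENNReal.ofReal (lam * Real.exp (-(lam + δ) * s)) *
        p.meanAtLoss P W Z ν w δ (p.flow p.xs s) := by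
  rw [meanPenalty_eq hlam hWZ hw (le_flow hp le_rfl ht),
    ← lintegral_const_mul' _ _ ENNReal.ofReal_ne_top, ← lintegral_indicator measurableSet_Ioi,
    ← lintegral_indicator measurableSet_Ioi]
  -- With indicators both sides are integrals over the whole line, and the substitution is
  -- translation invariance.
  refine Eq.trans (lintegral_congr fun s => ?_) (lintegral_add_left_eq_self _ t)
  by_cases hs : 0 < s
  · rw [indicator_of_mem (mem_Ioi.2 hs), indicator_of_mem (mem_Ioi.2 (by linarith)),
      flow_flow_xs hp ht hs.le, ← mul_assoc, ← ENNReal.ofReal_mul (Real.exp_pos _).le,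
      mul_left_comm, ← Real.exp_add]
    congr 4
    ring
  · rw [indicator_of_notMem (by simpa using hs), indicator_of_notMem (by simpa using hs)]

/-- The expected penalty from losses that do not trap the capital. -/
noncomputable def survivalMean (p : CapitalParams) (P : Measure Ω) (W Z : ℕ → Ω → ℝ)
    (ν : Measure ℝ) (w : ℝ → ℝ → ℝ) (δ u : ℝ) : ℝ :=
  ∫ z in Icc (p.xs / u) 1, p.realPenalty P W Z w δ (u * z) ∂ν

theorem measurable_realPenalty [SFinite P] (hWZ : IsLossInput P lam ν W Z)
    (hw : Measurable (Function.uncurry w)) : Measurable (p.realPenalty P W Z w δ) :=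
  (measurable_meanPenalty hWZ hw).ennreal_toReal

/-- The integral splits at `z = x*/u`, the largest proportion below which a loss traps. Finiteness
of the total lets `toReal` be applied to each part. -/
theorem toReal_meanAtLoss [SFinite P] (hp : p.Admissible) (hWZ : IsLossInput P lam ν W Z)
    (hν : ∀ᵐ z ∂ν, z ∈ Icc (0 : ℝ) 1) (hw : Measurable (Function.uncurry w))
    (hw0 : ∀ x₁ x₂, 0 ≤ x₁ → 0 < x₂ → x₂ ≤ p.xs → 0 ≤ w x₁ x₂)
    (hM : ∀ x, p.xs ≤ x → p.meanPenalty P W Z w δ x ≠ ⊤) {u : ℝ} (hu : p.xs ≤ u)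
    (hfin : p.meanAtLoss P W Z ν w δ u ≠ ⊤) :
    (p.meanAtLoss P W Z ν w δ u).toReal
      = p.trappingLoss ν w u + p.survivalMean P W Z ν w δ u := by
  have hu0 : 0 < u := hp.xs_pos.trans_le hu
  have hset : MeasurableSet (Iio (p.xs / u)) := measurableSet_Iio
  have hle : p.xs / u ≤ 1 := (div_le_one hu0).2 hu
  have hlt : ∀ z, z * u < p.xs ↔ z < p.xs / u := fun z => (lt_div_iff₀ hu0).symm
  -- Since `ν` lives on `[0, 1]`, the half-lines agree a.e. with the bounded intervals in the
  -- statement.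
  have e1 : (Iio (p.xs / u) : Set ℝ) =ᵐ[ν] Ico 0 (p.xs / u) := by
    filter_upwards [hν] with z hz
    exact propext ⟨fun h => ⟨hz.1, h⟩, fun h => h.2⟩
  have e2 : ((Iio (p.xs / u))ᶜ : Set ℝ) =ᵐ[ν] Icc (p.xs / u) 1 := by
    filter_upwards [hν] with z hz
    exact propext ⟨fun h => ⟨not_lt.1 h, hz.2⟩, fun h => not_lt.2 h.1⟩
  have hsplit : p.meanAtLoss P W Z ν w δ u =
      (∫⁻ z in Ico 0 (p.xs / u), ENNReal.ofReal (w (u - p.xs) (p.xs - u * z)) ∂ν)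
      + ∫⁻ z in Icc (p.xs / u) 1, p.meanPenalty P W Z w δ (u * z) ∂ν := by
    rw [meanAtLoss, ← lintegral_add_compl _ hset, ← Measure.restrict_congr_set e1,
      ← Measure.restrict_congr_set e2]
    congr 1
    · refine setLIntegral_congr_fun hset fun z hz => ?_
      simp only [if_pos ((hlt z).2 hz), mul_comm u z]
    · refine setLIntegral_congr_fun hset.compl fun z hz => ?_
      simp only [if_neg (fun h => hz ((hlt z).1 h)), mul_comm u z]
  rw [hsplit] at hfin ⊢
  rw [ENNReal.toReal_add (ne_top_of_le_ne_top hfin le_self_add)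
    (ne_top_of_le_ne_top hfin le_add_self)]
  congr 1
  · rw [trappingLoss, integral_eq_lintegral_of_nonneg_ae]
    · refine (ae_restrict_iff' measurableSet_Ico).2 (Eventually.of_forall fun z hz => ?_)
      have h1 : u * z < p.xs := by rw [mul_comm]; exact (hlt z).2 hz.2
      have h2 : 0 ≤ u * z := mul_nonneg hu0.le hz.1
      exact hw0 _ _ (by linarith) (by linarith) (by linarith)
    · exact (hw.comp (f := fun z => (u - p.xs, p.xs - u * z))
        (by fun_prop)).aestronglyMeasurable
  · rw [survivalMean]
    refine (integral_toReal ?_ ?_).symm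
    · exact ((measurable_meanPenalty hWZ hw).comp (by fun_prop)).aemeasurable
    · refine (ae_restrict_iff' measurableSet_Icc).2 (Eventually.of_forall fun z hz => ?_)
      refine (hM _ ?_).lt_top
      have := (div_le_iff₀ hu0).1 hz.1
      linarith

/-- The density, in the time of the first loss, of the expected discounted penalty from `x*`. -/
noncomputable def lossDensity (p : CapitalParams) (P : Measure Ω) (W Z : ℕ → Ω → ℝ)
    (lam : ℝ) (ν : Measure ℝ) (w : ℝ → ℝ → ℝ) (δ s : ℝ) : ℝ :=
  lam * Real.exp (-(lam + δ) * s) *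
    (p.trappingLoss ν w (p.flow p.xs s) + p.survivalMean P W Z ν w δ (p.flow p.xs s))

/-! ### From the renewal equation to continuity and derivatives. -/

section Renewal

variable [IsProbabilityMeasure P] [IsProbabilityMeasure ν]

theorem lossDensity_renewal (hp : p.Admissible) (hlam : 0 < lam)
    (hWZ : IsLossInput P lam ν W Z) (hν : ∀ᵐ z ∂ν, z ∈ Icc (0 : ℝ) 1)
    (hw : Measurable (Function.uncurry w))
    (hw0 : ∀ x₁ x₂, 0 ≤ x₁ → 0 < x₂ → x₂ ≤ p.xs → 0 ≤ w x₁ x₂)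
    (hM : ∀ x, p.xs ≤ x → p.meanPenalty P W Z w δ x ≠ ⊤) :
    IntegrableOn (p.lossDensity P W Z lam ν w δ) (Ioi 0) ∧
    ∀ t, 0 ≤ t → p.realPenalty P W Z w δ (p.flow p.xs t)
      = Real.exp ((lam + δ) * t) * ∫ s in Ioi t, p.lossDensity P W Z lam ν w δ s := by
  set G : ℝ → ENNReal := fun s => ENNReal.ofReal (lam * Real.exp (-(lam + δ) * s)) *
        p.meanAtLoss P W Z ν w δ (p.flow p.xs s) with hG
  have hGm : Measurable G := Measurable.mul (by fun_prop)
    ((measurable_meanAtLoss hWZ hw).comp (Measurable.flow measurable_const measurable_id))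
  have hGfin : ∫⁻ s in Ioi 0, G s ≠ ⊤ := by
    have h1 := meanPenalty_flow_xs (δ := δ) hp hlam.le hWZ hw le_rfl
    have h2 := hM _ (le_flow hp le_rfl le_rfl)
    rw [h1] at h2
    simpa [hG] using h2
  have hpos : ∀ s, 0 < lam * Real.exp (-(lam + δ) * s) := fun s => mul_pos hlam (Real.exp_pos _)
  have hae : ∀ᵐ s ∂(volume.restrict (Ioi (0 : ℝ))),
      G s < ⊤ ∧ (G s).toReal = p.lossDensity P W Z lam ν w δ s := by
    filter_upwards [ae_lt_top hGm hGfin, ae_restrict_mem measurableSet_Ioi] with s hs hs0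
    refine ⟨hs, ?_⟩
    -- The weight is positive, so an infinite mean would make `G s` infinite; this is excluded for
    -- almost every `s`, which suffices under the integral.
    have hne : p.meanAtLoss P W Z ν w δ (p.flow p.xs s) ≠ ⊤ := by
      intro h
      simp only [hG, h] at hs
      rw [ENNReal.mul_top (by simpa using hpos s)] at hs
      exact lt_irrefl _ hs
    rw [hG, ENNReal.toReal_mul, ENNReal.toReal_ofReal (hpos s).le,
      toReal_meanAtLoss hp hWZ hν hw hw0 hM (le_flow hp le_rfl (le_of_lt hs0)) hne, lossDensity]
  refine ⟨(integrable_toReal_of_lintegral_ne_top hGm.aemeasurable hGfin).congr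
    (hae.mono fun s hs => hs.2), fun t ht => ?_⟩
  have hae' := ae_restrict_of_ae_restrict_of_subset (Ioi_subset_Ioi ht) hae
  rw [realPenalty, meanPenalty_flow_xs hp hlam.le hWZ hw ht, ENNReal.toReal_mul,
    ENNReal.toReal_ofReal (Real.exp_pos _).le,
    ← integral_toReal hGm.aemeasurable (hae'.mono fun s hs => hs.1)]
  congr 1
  exact integral_congr_ae (hae'.mono fun s hs => hs.2)

theorem realPenalty_flow (hp : p.Admissible) (hlam : 0 < lam)
    (hWZ : IsLossInput P lam ν W Z) (hν : ∀ᵐ z ∂ν, z ∈ Icc (0 : ℝ) 1)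
    (hw : Measurable (Function.uncurry w))
    (hw0 : ∀ x₁ x₂, 0 ≤ x₁ → 0 < x₂ → x₂ ≤ p.xs → 0 ≤ w x₁ x₂)
    (hM : ∀ x, p.xs ≤ x → p.meanPenalty P W Z w δ x ≠ ⊤) {t : ℝ} (ht : 0 ≤ t) :
    p.realPenalty P W Z w δ (p.flow p.xs t) = Real.exp ((lam + δ) * t) *
      ((∫ s in Ioi 0, p.lossDensity P W Z lam ν w δ s)
        - ∫ s in (0 : ℝ)..t, p.lossDensity P W Z lam ν w δ s) := by
  obtain ⟨h1, h2⟩ := lossDensity_renewal hp hlam hWZ hν hw hw0 hM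
  rw [h2 t ht, ← intervalIntegral.integral_Ioi_sub_Ioi h1 ht]
  ring

/-- The primitive of an integrable function is continuous, and so is `hit`. No continuity of `w` or
of the law `ν` enters, which starts the bootstrap. -/
theorem continuousOn_realPenalty (hp : p.Admissible) (hlam : 0 < lam)
    (hWZ : IsLossInput P lam ν W Z) (hν : ∀ᵐ z ∂ν, z ∈ Icc (0 : ℝ) 1)
    (hw : Measurable (Function.uncurry w))
    (hw0 : ∀ x₁ x₂, 0 ≤ x₁ → 0 < x₂ → x₂ ≤ p.xs → 0 ≤ w x₁ x₂)
    (hM : ∀ x, p.xs ≤ x → p.meanPenalty P W Z w δ x ≠ ⊤) :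
    ContinuousOn (p.realPenalty P W Z w δ) (Ici p.xs) := by
  -- Extending the density by zero makes it integrable on the whole line, so its primitive is
  -- continuous everywhere.
  have hint := (lossDensity_renewal hp hlam hWZ hν hw hw0 hM).1.integrable_indicator
    measurableSet_Ioi
  have hcont : Continuous fun t => Real.exp ((lam + δ) * t) *
      ((∫ s in Ioi 0, p.lossDensity P W Z lam ν w δ s)
        - ∫ s in (0 : ℝ)..t, (Ioi (0 : ℝ)).indicator (p.lossDensity P W Z lam ν w δ) s) :=
    Continuous.mul (by fun_prop) (continuous_const.sub
      (intervalIntegral.continuous_primitive (fun a b => hint.intervalIntegrable) 0))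
  refine (hcont.comp_continuousOn (continuousOn_hit hp)).congr fun u hu => ?_
  have h0 := hit_nonneg hp hu
  have e := realPenalty_flow hp hlam hWZ hν hw hw0 hM h0
  rw [flow_hit hp hu] at e
  rw [e, Function.comp_apply]
  congr 2
  refine intervalIntegral.integral_congr_ae (Eventually.of_forall fun s hs => ?_)
  rw [uIoc_of_le h0] at hs
  rw [indicator_of_mem (mem_Ioi.2 hs.1)]

/-- Dominated convergence: for `z ≠ x*/x` the indicator is constant for `u` near `x`, and for `u < x
+ 1` the function `m` is only evaluated on the compact interval `[x*, x + 1]`. -/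
theorem continuousWithinAt_survivalMean (hp : p.Admissible) (hWZ : IsLossInput P lam ν W Z)
    (hν : ∀ᵐ z ∂ν, z ∈ Icc (0 : ℝ) 1) (hw : Measurable (Function.uncurry w))
    (hcont : ContinuousOn (p.realPenalty P W Z w δ) (Ici p.xs)) {x : ℝ} (hx : p.xs ≤ x)
    (hatom : ν {p.xs / x} = 0) :
    ContinuousWithinAt (p.survivalMean P W Z ν w δ) (Ici p.xs) x := by
  have hx0 : 0 < x := hp.xs_pos.trans_le hx
  obtain ⟨C, hC⟩ := isCompact_Icc.exists_bound_of_continuousOn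
    (hcont.mono (Icc_subset_Ici_self : Icc p.xs (x + 1) ⊆ Ici p.xs))
  have hmeas := measurable_realPenalty (p := p) (δ := δ) hWZ hw
  have hrw : p.survivalMean P W Z ν w δ = fun u => ∫ z, (Icc (p.xs / u) 1).indicator
      (fun z => p.realPenalty P W Z w δ (u * z)) z ∂ν := by
    funext u
    rw [integral_indicator measurableSet_Icc, survivalMean]
  have hne : ∀ᵐ z ∂ν, z ≠ p.xs / x := by simpa [ae_iff] using hatom
  rw [hrw]
  refine continuousWithinAt_of_dominated (bound := fun _ => max C 0) ?_ ?_ (integrable_const _) ?_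
  · exact Eventually.of_forall fun u => ((hmeas.comp (by fun_prop)).indicator
      measurableSet_Icc).aestronglyMeasurable
  · filter_upwards [self_mem_nhdsWithin,
      mem_nhdsWithin_of_mem_nhds (Iio_mem_nhds (show x < x + 1 by linarith))] with u hu hu1
    have hu0 : 0 < u := hp.xs_pos.trans_le hu
    refine Eventually.of_forall fun z => ?_
    by_cases hz : z ∈ Icc (p.xs / u) 1
    · rw [indicator_of_mem hz]
      have h1 := (div_le_iff₀ hu0).1 hz.1
      have h2 := mul_le_mul_of_nonneg_left hz.2 hu0.le
      have h3 : u < x + 1 := hu1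
      exact (hC _ ⟨by linarith, by linarith⟩).trans (le_max_left _ _)
    · rw [indicator_of_notMem hz, norm_zero]
      exact le_max_right _ _
  · filter_upwards [hν, hne] with z hz hzne
    have hcm : ContinuousWithinAt (fun u : ℝ => u * z) (Ici p.xs) x := by fun_prop
    rcases lt_or_gt_of_ne hzne with h | h
    · have h1 : x * z < p.xs := by rw [mul_comm]; exact (lt_div_iff₀ hx0).1 h
      have hev : (fun u => (Icc (p.xs / u) 1).indicator
          (fun z => p.realPenalty P W Z w δ (u * z)) z) =ᶠ[𝓝[Ici p.xs] x] fun _ => 0 := by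
        filter_upwards [self_mem_nhdsWithin, hcm.eventually (Iio_mem_nhds h1)] with u hu hlt
        have hu0 : 0 < u := hp.xs_pos.trans_le hu
        refine indicator_of_notMem (fun hz' => ?_) _
        have := (div_le_iff₀ hu0).1 hz'.1
        have h3 : u * z < p.xs := hlt
        linarith
      exact continuousWithinAt_const.congr_of_eventuallyEq hev (hev.self_of_nhdsWithin hx)
    · have h1 : p.xs < x * z := by rw [mul_comm]; exact (div_lt_iff₀ hx0).1 h
      have hge := hcm.eventually (Ioi_mem_nhds h1)
      have hev : (fun u => (Icc (p.xs / u) 1).indicator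
          (fun z => p.realPenalty P W Z w δ (u * z)) z) =ᶠ[𝓝[Ici p.xs] x]
          fun u => p.realPenalty P W Z w δ (u * z) := by
        filter_upwards [self_mem_nhdsWithin, hge] with u hu hlt
        have hu0 : 0 < u := hp.xs_pos.trans_le hu
        refine indicator_of_mem (show z ∈ Icc (p.xs / u) 1 from ⟨(div_le_iff₀ hu0).2 ?_, hz.2⟩) _
        have h3 : p.xs < u * z := hlt
        linarith
      refine ContinuousWithinAt.congr_of_eventuallyEq ?_ hev (hev.self_of_nhdsWithin hx)
      refine ContinuousAt.comp_continuousWithinAt (g := p.realPenalty P W Z w δ) ?_ hcm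
      exact (hcont _ h1.le).continuousAt (Ici_mem_nhds h1)

/-- Product rule and fundamental theorem of calculus for the tail form. Working within `[a, b]`
allows `A` to be continuous only from one side of `B`. -/
theorem hasDerivWithinAt_realPenalty_flow (hp : p.Admissible) (hlam : 0 < lam)
    (hWZ : IsLossInput P lam ν W Z) (hν : ∀ᵐ z ∂ν, z ∈ Icc (0 : ℝ) 1)
    (hw : Measurable (Function.uncurry w))
    (hw0 : ∀ x₁ x₂, 0 ≤ x₁ → 0 < x₂ → x₂ ≤ p.xs → 0 ≤ w x₁ x₂)
    (hM : ∀ x, p.xs ≤ x → p.meanPenalty P W Z w δ x ≠ ⊤) {a b t : ℝ} (ha : 0 ≤ a) (hat : a ≤ t)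
    (htb : t ≤ b) (hatom : ν {p.xs / p.flow p.xs t} = 0)
    (hA : ContinuousWithinAt (fun s => p.trappingLoss ν w (p.flow p.xs s)) (Icc a b) t) :
    HasDerivWithinAt (fun s => p.realPenalty P W Z w δ (p.flow p.xs s))
      ((lam + δ) * p.realPenalty P W Z w δ (p.flow p.xs t)
        - lam * (p.trappingLoss ν w (p.flow p.xs t)
          + p.survivalMean P W Z ν w δ (p.flow p.xs t))) (Icc a b) t := by
  have ht : 0 ≤ t := ha.trans hat
  have hsub : Icc a b ⊆ Ici 0 := fun s hs => ha.trans hs.1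
  have hint := (lossDensity_renewal hp hlam hWZ hν hw hw0 hM).1
  have hint' : IntegrableOn (p.lossDensity P W Z lam ν w δ) (Ici 0) :=
    (integrableOn_Ici_iff_integrableOn_Ioi (by finiteness)).2 hint
  have hflow : ContinuousWithinAt (fun s => p.flow p.xs s) (Icc a b) t :=
    (continuousOn_flow hp p.xs t ht).mono hsub
  have hS : ContinuousWithinAt (fun s => p.survivalMean P W Z ν w δ (p.flow p.xs s)) (Icc a b) t :=
    (continuousWithinAt_survivalMean hp hWZ hν hw
      (continuousOn_realPenalty hp hlam hWZ hν hw hw0 hM) (le_flow hp le_rfl ht) hatom).comp hflow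
      fun s hs => le_flow hp le_rfl (hsub hs)
  have hcont : ContinuousWithinAt (p.lossDensity P W Z lam ν w δ) (Icc a b) t :=
    ContinuousWithinAt.mul (by fun_prop) (hA.add hS)
  -- The one-sided fundamental theorem of calculus finds its filter on `[a, b]` through this
  -- instance.
  have : Fact (t ∈ Icc a b) := ⟨⟨hat, htb⟩⟩
  have hder : HasDerivWithinAt (fun u => ∫ s in (0 : ℝ)..u, p.lossDensity P W Z lam ν w δ s)
      (p.lossDensity P W Z lam ν w δ t) (Icc a b) t := by
    refine intervalIntegral.integral_hasDerivWithinAt_right ?_ (t := Icc a b)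
      ⟨Icc a b, self_mem_nhdsWithin, (hint'.mono_set hsub).aestronglyMeasurable⟩ hcont
    exact (intervalIntegrable_iff_integrableOn_Ioc_of_le ht).2 (hint.mono_set Ioc_subset_Ioi_self)
  have hexp : HasDerivWithinAt (fun s => Real.exp ((lam + δ) * s))
      (Real.exp ((lam + δ) * t) * ((lam + δ) * 1)) (Icc a b) t :=
    ((hasDerivAt_id t).const_mul (lam + δ)).exp.hasDerivWithinAt
  have := (hexp.mul (hder.const_sub (∫ s in Ioi 0, p.lossDensity P W Z lam ν w δ s))).congr
    (fun s hs => realPenalty_flow hp hlam hWZ hν hw hw0 hM (hsub hs))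
    (realPenalty_flow hp hlam hWZ hν hw hw0 hM ht)
  refine this.congr_deriv ?_
  rw [realPenalty_flow hp hlam hWZ hν hw hw0 hM ht, lossDensity, neg_mul, Real.exp_neg]
  have := (Real.exp_pos ((lam + δ) * t)).ne'
  field_simp
  ring

/-- The derivative of the expected discounted penalty above `B`. -/
theorem hasDerivWithinAt_realPenalty_top (hp : p.Admissible) (hlam : 0 < lam)
    (hWZ : IsLossInput P lam ν W Z) (hν : ∀ᵐ z ∂ν, z ∈ Icc (0 : ℝ) 1)
    (hw : Measurable (Function.uncurry w))
    (hw0 : ∀ x₁ x₂, 0 ≤ x₁ → 0 < x₂ → x₂ ≤ p.xs → 0 ≤ w x₁ x₂)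
    (hM : ∀ x, p.xs ≤ x → p.meanPenalty P W Z w δ x ≠ ⊤) {x : ℝ} (hx : p.B ≤ x)
    (hatom : ν {p.xs / x} = 0) (hA : ContinuousWithinAt (p.trappingLoss ν w) (Ici p.B) x) :
    HasDerivWithinAt (p.realPenalty P W Z w δ)
      (((lam + δ) * p.realPenalty P W Z w δ x
        - lam * (p.trappingLoss ν w x + p.survivalMean P W Z ν w δ x)) * (p.r * (x - p.xs))⁻¹)
      (Ici p.B) x := by
  have hxs : p.xs ≤ x := hp.xs_lt_B.le.trans hx
  have hT := (timeToB_pos hp le_rfl hp.xs_lt_B).le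
  have hfx := flow_hit hp hxs
  have hT1 := timeToB_le_hit hp hx
  have hsub : Icc (p.timeToB p.xs) (p.hit x + 1) ⊆ Ici 0 := fun s hs => hT.trans hs.1
  have h1 := hasDerivWithinAt_realPenalty_flow hp hlam hWZ hν hw hw0 hM hT hT1
    (b := p.hit x + 1) (by linarith) (by rwa [hfx]) (by
      have hA' : ContinuousWithinAt (p.trappingLoss ν w) (Ici p.B) (p.flow p.xs (p.hit x)) := by
        rwa [hfx]
      exact hA'.comp ((continuousOn_flow hp p.xs _ (hit_nonneg hp hxs)).mono hsub)
        fun s hs => le_flow_xs hp hs.1)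
  rw [hfx] at h1
  -- Near `hit x` the bounded interval coincides with the half-line, which is where `hit` maps `[B,
  -- ∞)`.
  have h2 : HasDerivWithinAt (fun s => p.realPenalty P W Z w δ (p.flow p.xs s)) _
      (Ici (p.timeToB p.xs)) (p.hit x) := h1.mono_of_mem_nhdsWithin (by
    rw [← Ici_inter_Iic]
    exact inter_mem self_mem_nhdsWithin
      (mem_nhdsWithin_of_mem_nhds (Iic_mem_nhds (by linarith))))
  have h3 : HasDerivWithinAt p.hit (p.r * (x - p.xs))⁻¹ (Ici p.B) x :=
    (hasDerivAt_hitTop hp hx).hasDerivWithinAt.congr (fun u hu => hit_of_ge hp hu)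
      (hit_of_ge hp hx)
  refine (HasDerivWithinAt.comp x h2 h3 fun u hu => timeToB_le_hit hp hu).congr
    (fun u hu => ?_) ?_
  · rw [Function.comp_apply, flow_hit hp (hp.xs_lt_B.le.trans hu)]
  · rw [Function.comp_apply, hfx]

/-- The derivative of the expected discounted penalty between `x*` and `B`. -/
theorem hasDerivWithinAt_realPenalty_mid (hp : p.Admissible) (hlam : 0 < lam)
    (hWZ : IsLossInput P lam ν W Z) (hν : ∀ᵐ z ∂ν, z ∈ Icc (0 : ℝ) 1)
    (hw : Measurable (Function.uncurry w))
    (hw0 : ∀ x₁ x₂, 0 ≤ x₁ → 0 < x₂ → x₂ ≤ p.xs → 0 ≤ w x₁ x₂)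
    (hM : ∀ x, p.xs ≤ x → p.meanPenalty P W Z w δ x ≠ ⊤) {x : ℝ} (hx : p.xs ≤ x) (hxB : x < p.B)
    (hatom : ν {p.xs / x} = 0) (hA : ContinuousWithinAt (p.trappingLoss ν w) (Ico p.xs p.B) x) :
    HasDerivWithinAt (p.realPenalty P W Z w δ)
      (((lam + δ) * p.realPenalty P W Z w δ x
        - lam * (p.trappingLoss ν w x + p.survivalMean P W Z ν w δ x))
          * ((p.r - p.cT) * (x + p.xss))⁻¹) (Ico p.xs p.B) x := by
  have hfx := flow_hit hp hx
  have hT0 := hit_nonneg hp hx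
  have hT1 := hit_lt hp hx hxB
  -- Stopping strictly before the arrival at `B` keeps the trajectory in `[x*, B)`, the set on which
  -- `A` is assumed continuous at `x`.
  obtain ⟨b, hb1, hb2⟩ := exists_between hT1
  have h1 := hasDerivWithinAt_realPenalty_flow hp hlam hWZ hν hw hw0 hM le_rfl hT0
    (b := b) hb1.le (by rwa [hfx]) (by
      have hA' : ContinuousWithinAt (p.trappingLoss ν w) (Ico p.xs p.B)
          (p.flow p.xs (p.hit x)) := by
        rwa [hfx]
      exact hA'.comp ((continuousOn_flow hp p.xs _ (hit_nonneg hp hx)).mono Icc_subset_Ici_self)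
        fun s hs => ⟨le_flow hp le_rfl hs.1, flow_xs_lt hp (hs.2.trans_lt hb2)⟩)
  rw [hfx] at h1
  have h2 : HasDerivWithinAt (fun s => p.realPenalty P W Z w δ (p.flow p.xs s)) _
      (Ici 0) (p.hit x) := h1.mono_of_mem_nhdsWithin (by
    rw [← Ici_inter_Iic]
    exact inter_mem self_mem_nhdsWithin
      (mem_nhdsWithin_of_mem_nhds (Iic_mem_nhds hb1)))
  have h3 : HasDerivWithinAt p.hit ((p.r - p.cT) * (x + p.xss))⁻¹ (Ico p.xs p.B) x :=
    (hasDerivAt_hitMid hp hx hxB.le).hasDerivWithinAt.congr (fun u hu => hit_of_le hu.2.le)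
      (hit_of_le hxB.le)
  refine (HasDerivWithinAt.comp x h2 h3 fun u hu => hit_nonneg hp hu.1).congr
    (fun u hu => ?_) ?_
  · rw [Function.comp_apply, flow_hit hp hu.1]
  · rw [Function.comp_apply, hfx]

/-- The expected discounted penalty is integrable against the law of a loss that does not trap. -/
theorem integrableOn_realPenalty (hp : p.Admissible) (hWZ : IsLossInput P lam ν W Z)
    (hw : Measurable (Function.uncurry w))
    (hcont : ContinuousOn (p.realPenalty P W Z w δ) (Ici p.xs)) {x : ℝ} (hx : p.xs ≤ x) :
    IntegrableOn (fun z => p.realPenalty P W Z w δ (x * z)) (Icc (p.xs / x) 1) ν := by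
  have hx0 : 0 < x := hp.xs_pos.trans_le hx
  obtain ⟨C, hC⟩ := isCompact_Icc.exists_bound_of_continuousOn
    (hcont.mono (Icc_subset_Ici_self : Icc p.xs x ⊆ Ici p.xs))
  refine Measure.integrableOn_of_bounded (M := C) (measure_ne_top _ _)
    ((measurable_realPenalty hWZ hw).comp (by fun_prop)).aestronglyMeasurable ?_
  refine (ae_restrict_iff' measurableSet_Icc).2 (Eventually.of_forall fun z hz => ?_)
  have h1 := (div_le_iff₀ hx0).1 hz.1
  have h2 := mul_le_mul_of_nonneg_left hz.2 hx0.le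
  exact hC _ ⟨by linarith, by linarith⟩

end Renewal

end CapitalParams

/-! ### Laws of large numbers for the input -/

theorem integrable_id_expMeasure {lam : ℝ} (hlam : 0 < lam) :
    Integrable (fun t : ℝ => t) (expMeasure lam) ∧ ∫ t, t ∂(expMeasure lam) = 1 / lam := by
  have hval : ∫ t in Ioi (0 : ℝ), lam * Real.exp (-lam * t) * t = 1 / lam := by
    have h := Real.integral_rpow_mul_exp_neg_mul_Ioi (a := 2) (r := lam) (by norm_num) hlam
    rw [Real.Gamma_two, mul_one] at h
    have h3 : ∀ t : ℝ, lam * Real.exp (-lam * t) * t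
        = lam * (t ^ ((2 : ℝ) - 1) * Real.exp (-(lam * t))) := fun t => by
      norm_num
      ring
    simp only [h3]
    rw [integral_const_mul, h]
    norm_num
    field_simp
  have hint : IntegrableOn (fun t => lam * Real.exp (-lam * t) * t) (Ioi (0 : ℝ)) := by
    -- A nonintegrable function has Bochner integral `0`, but the value found is `1/λ > 0`.
    by_contra hne
    rw [integral_undef hne] at hval
    exact (one_div_pos.2 hlam).ne hval
  have hl : ∫⁻ t, ENNReal.ofReal t ∂(expMeasure lam) = ENNReal.ofReal (1 / lam) := by
    rw [lintegral_expMeasure lam (by fun_prop), ← hval, ofReal_integral_eq_lintegral_ofReal hint]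
    · refine lintegral_congr fun t => ?_
      rw [ENNReal.ofReal_mul (mul_nonneg hlam.le (Real.exp_pos _).le)]
    · filter_upwards [ae_restrict_mem measurableSet_Ioi] with t ht
      exact mul_nonneg (mul_nonneg hlam.le (Real.exp_pos _).le) (le_of_lt ht)
  have hnn : ∀ᵐ t ∂(expMeasure lam), 0 ≤ t := (ae_pos_expMeasure lam).mono fun t ht => ht.le
  have hm : AEStronglyMeasurable (fun t : ℝ => t) (expMeasure lam) :=
    measurable_id.aestronglyMeasurable
  refine ⟨⟨hm, (hasFiniteIntegral_iff_ofReal hnn).2 ?_⟩, ?_⟩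
  · rw [hl]
    exact ENNReal.ofReal_lt_top
  · rw [integral_eq_lintegral_of_nonneg_ae hnn hm, hl, ENNReal.toReal_ofReal (by positivity)]

theorem strong_law_comp {Ω : Type*} [MeasurableSpace Ω] {P : Measure Ω} {Y : ℕ → Ω → ℝ}
    {μ : Measure ℝ} (hm : ∀ i, Measurable (Y i)) (hlaw : ∀ i, P.map (Y i) = μ)
    (hind : iIndepFun Y P) {f : ℝ → ℝ} (hf : Measurable f) (hint : Integrable f μ) :
    ∀ᵐ ω ∂P, Tendsto (fun n : ℕ => (∑ i ∈ Finset.range n, f (Y i ω)) / n) atTop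
      (𝓝 (∫ y, f y ∂μ)) := by
  have h := strong_law_ae_real (μ := P) (fun i ω => f (Y i ω)) ?_ ?_ ?_
  · rwa [← hlaw 0, integral_map (hm 0).aemeasurable hf.aestronglyMeasurable]
  · rw [← hlaw 0] at hint
    exact hint.comp_measurable (hm 0)
  · intro i j hij
    exact (hind.indepFun hij).comp hf hf
  · intro i
    refine IdentDistrib.comp (u := f) ⟨(hm i).aemeasurable, (hm 0).aemeasurable, ?_⟩ hf
    rw [hlaw, hlaw]

namespace IsLossInput

variable {Ω : Type*} [MeasurableSpace Ω] {P : Measure Ω} {lam : ℝ} {ν : Measure ℝ}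
  {W Z : ℕ → Ω → ℝ}

theorem ae_tendsto_wait (h : IsLossInput P lam ν W Z) (hlam : 0 < lam) :
    ∀ᵐ ω ∂P, Tendsto (fun n : ℕ => (∑ i ∈ Finset.range n, W i ω) / n) atTop (𝓝 (1 / lam)) := by
  have hind : iIndepFun W P := h.indep.precomp (g := Sum.inl) Sum.inl_injective
  obtain ⟨h1, h2⟩ := integrable_id_expMeasure hlam
  rw [← h2]
  exact strong_law_comp h.measurable_wait h.law_wait hind measurable_id h1

theorem ae_tendsto_log_prop (h : IsLossInput P lam ν W Z) (hint : Integrable Real.log ν) :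
    ∀ᵐ ω ∂P, Tendsto (fun n : ℕ => (∑ i ∈ Finset.range n, Real.log (Z i ω)) / n) atTop
      (𝓝 (∫ z, Real.log z ∂ν)) := by
  have hind : iIndepFun Z P := h.indep.precomp (g := Sum.inr) Sum.inr_injective
  exact strong_law_comp h.measurable_prop h.law_prop hind Real.measurable_log hint

end IsLossInput

namespace CapitalParams

variable {p : CapitalParams}

/-! ### Large initial capital -/

/-- The factor by which an excess over `x*` grows up to the `n`-th loss, in the absence of
transfers. -/
noncomputable def growthFactor (p : CapitalParams) (W Z : ℕ → ℝ) (n : ℕ) : ℝ :=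
  ∏ i ∈ Finset.range n, (Z i * Real.exp (p.r * W i))

theorem growthFactor_pos {W Z : ℕ → ℝ} (hZ : ∀ i, 0 < Z i) (n : ℕ) : 0 < p.growthFactor W Z n :=
  Finset.prod_pos fun i _ => mul_pos (hZ i) (Real.exp_pos _)

theorem growthFactor_eq_exp {W Z : ℕ → ℝ} (hZ : ∀ i, 0 < Z i) (n : ℕ) :
    p.growthFactor W Z n = Real.exp (p.r * (∑ i ∈ Finset.range n, W i)
      + ∑ i ∈ Finset.range n, Real.log (Z i)) := by
  rw [Finset.mul_sum, ← Finset.sum_add_distrib, Real.exp_sum, growthFactor]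
  refine Finset.prod_congr rfl fun i _ => ?_
  rw [Real.exp_add, Real.exp_log (hZ i), mul_comm]

/-- Without transfers the excess `Y` over `x*` satisfies `Y_{n+1} ≥ Z_n e^{r W_n} Y_n - x*`;
dividing by the growth factor makes these inequalities telescope. -/
theorem growthFactor_mul_le (h : p.Admissible) {W Z : ℕ → ℝ} {x : ℝ} (hW : ∀ i, 0 < W i)
    (hZ : ∀ i, 0 < Z i) (n : ℕ)
    (hx : p.xs * ∑ k ∈ Finset.range n, (p.growthFactor W Z (k + 1))⁻¹ < x - p.xs) :
    p.growthFactor W Z n *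
        (x - p.xs - p.xs * ∑ k ∈ Finset.range n, (p.growthFactor W Z (k + 1))⁻¹)
      ≤ p.afterLoss W Z x n - p.xs := by
  induction n with
  | zero => simp [growthFactor, afterLoss]
  | succ n ih =>
    have hE := growthFactor_pos (p := p) (W := W) hZ (n + 1)
    have hEn := growthFactor_pos (p := p) (W := W) hZ n
    have hxs := h.xs_pos
    rw [Finset.sum_range_succ, mul_add] at hx ⊢
    have hpos : 0 < p.xs * (p.growthFactor W Z (n + 1))⁻¹ := mul_pos hxs (inv_pos.2 hE)
    have ih' := ih ((lt_add_of_pos_right _ hpos).trans hx)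
    have hfl := flowTop_le_flow h (p.afterLoss W Z x n) (hW n).le
    have hstep : Z n * ((p.afterLoss W Z x n - p.xs) * Real.exp (p.r * W n) + p.xs)
        ≤ p.afterLoss W Z x (n + 1) := mul_le_mul_of_nonneg_left hfl (hZ n).le
    have hsucc : p.growthFactor W Z (n + 1) = p.growthFactor W Z n * (Z n * Real.exp (p.r * W n)) :=
      Finset.prod_range_succ _ _
    have hmul := mul_le_mul_of_nonneg_right ih' (mul_pos (hZ n) (Real.exp_pos (p.r * W n))).le
    have hZx : 0 < Z n * p.xs := mul_pos (hZ n) hxs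
    have hcancel : p.growthFactor W Z (n + 1) * (p.xs * (p.growthFactor W Z (n + 1))⁻¹) = p.xs := by
      field_simp
    rw [← sub_sub, mul_sub, hcancel, hsucc]
    -- The term `Z_n x* > 0` that survives the loss is discarded.
    nlinarith

/-- The partial sums increase, so the threshold for `n` losses also serves for fewer. -/
theorem le_afterLoss_of_large (h : p.Admissible) {W Z : ℕ → ℝ} {x : ℝ} (hW : ∀ i, 0 < W i)
    (hZ : ∀ i, 0 < Z i) {n : ℕ}
    (hx : p.xs * ∑ k ∈ Finset.range n, (p.growthFactor W Z (k + 1))⁻¹ < x - p.xs) {k : ℕ}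
    (hk : k ≤ n) : p.xs ≤ p.afterLoss W Z x k := by
  have hsum : ∑ k ∈ Finset.range k, (p.growthFactor W Z (k + 1))⁻¹
      ≤ ∑ k ∈ Finset.range n, (p.growthFactor W Z (k + 1))⁻¹ :=
    Finset.sum_le_sum_of_subset_of_nonneg (Finset.range_mono hk) fun i _ _ =>
      (inv_pos.2 (growthFactor_pos hZ _)).le
  have hlt := (mul_le_mul_of_nonneg_left hsum h.xs_pos.le).trans_lt hx
  have := growthFactor_mul_le h hW hZ k hlt
  have := mul_pos (growthFactor_pos (p := p) (W := W) hZ k) (sub_pos.2 hlt)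
  linarith

theorem tendsto_discountedPenalty_of_discount (h : p.Admissible) {w : ℝ → ℝ → ℝ}
    (hw0 : ∀ x₁ x₂, 0 ≤ x₁ → 0 < x₂ → x₂ ≤ p.xs → 0 ≤ w x₁ x₂) {C : ℝ}
    (hC : ∀ x₁ x₂, 0 ≤ x₁ → 0 < x₂ → x₂ ≤ p.xs → w x₁ x₂ ≤ C) {δ : ℝ} (hδ : 0 < δ) {W Z : ℕ → ℝ}
    (hW : ∀ i, 0 < W i) (hZ : ∀ i, 0 < Z i) (hlim : Tendsto (lossTime W) atTop atTop) :
    Tendsto (fun x => p.discountedPenalty w δ W Z x) atTop (𝓝 0) := by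
  have hexp : Tendsto (fun n => max C 0 * Real.exp (-(δ * lossTime W n))) atTop (𝓝 0) := by
    have := (Real.tendsto_exp_neg_atTop_nhds_zero.comp
      (hlim.const_mul_atTop hδ)).const_mul (max C 0)
    simpa using this
  rw [Metric.tendsto_nhds]
  intro ε hε
  -- Choose `n` so that a penalty discounted to the `n`-th loss is below `ε`; a large `x` then rules
  -- out trapping before that loss.
  obtain ⟨n, hn⟩ := (hexp.eventually (gt_mem_nhds hε)).exists
  filter_upwards [eventually_gt_atTop (p.xs +
    p.xs * ∑ k ∈ Finset.range n, (p.growthFactor W Z (k + 1))⁻¹), eventually_ge_atTop p.xs]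
    with x hx hxs
  have hnn := discountedPenalty_nonneg h hw0 δ hxs hW fun i => (hZ i).le
  rw [Real.dist_eq, sub_zero, abs_of_nonneg hnn]
  rcases trappedAt_or (p := p) (W := W) (Z := Z) hxs with ⟨m, hm⟩ | hA
  · rw [discountedPenalty_of_trappedAt h w δ hW hm]
    have hnm : n ≤ m + 1 := by
      by_contra hlt
      exact absurd (le_afterLoss_of_large h hW hZ (k := m + 1) (lt_sub_iff_add_lt'.2 hx) (by omega))
        (not_le.2 hm.2)
    have ht := (strictMono_lossTime hW).monotone hnm
    refine (penaltyAt_le h hC δ hW (fun i => (hZ i).le) hm).trans_lt (lt_of_le_of_lt ?_ hn)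
    refine mul_le_mul (le_max_left _ _) (Real.exp_le_exp.2 ?_) (Real.exp_pos _).le
      (le_max_right _ _)
    have := mul_le_mul_of_nonneg_left ht hδ.le
    linarith
  · rw [discountedPenalty_of_not_trapped h w δ hW hA]
    exact hε

/-- With the full series as threshold the capital is never trapped, so the penalty is exactly zero
for large `x`. -/
theorem tendsto_discountedPenalty_of_summable (h : p.Admissible) (w : ℝ → ℝ → ℝ) (δ : ℝ)
    {W Z : ℕ → ℝ} (hW : ∀ i, 0 < W i) (hZ : ∀ i, 0 < Z i)
    (hsum : Summable fun k => (p.growthFactor W Z (k + 1))⁻¹) :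
    Tendsto (fun x => p.discountedPenalty w δ W Z x) atTop (𝓝 0) := by
  refine tendsto_const_nhds.congr' ?_
  filter_upwards [eventually_gt_atTop (p.xs +
    p.xs * ∑' k, (p.growthFactor W Z (k + 1))⁻¹)] with x hx
  refine (discountedPenalty_of_not_trapped h w δ hW fun n => ?_).symm
  refine le_afterLoss_of_large h hW hZ (n := n) ?_ le_rfl
  have := mul_le_mul_of_nonneg_left (hsum.sum_le_tsum (Finset.range n) fun i _ =>
    (inv_pos.2 (growthFactor_pos hZ _)).le) h.xs_pos.le
  exact this.trans_lt (lt_sub_iff_add_lt'.2 hx)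

/-- The logarithm of the growth factor grows linearly at rate `r a + b > 0`; any smaller `c > 0`
gives a geometric majorant `e^{-cn}`. -/
theorem summable_inv_growthFactor {W Z : ℕ → ℝ} (hZ : ∀ i, 0 < Z i) {a b : ℝ}
    (hWlim : Tendsto (fun n : ℕ => (∑ i ∈ Finset.range n, W i) / n) atTop (𝓝 a))
    (hZlim : Tendsto (fun n : ℕ => (∑ i ∈ Finset.range n, Real.log (Z i)) / n) atTop (𝓝 b))
    (hab : 0 < p.r * a + b) : Summable fun k => (p.growthFactor W Z (k + 1))⁻¹ := by
  obtain ⟨c, hc0, hc⟩ := exists_between hab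
  have hlim := (hWlim.const_mul p.r).add hZlim
  have hev : ∀ᶠ n : ℕ in atTop, ‖(p.growthFactor W Z n)⁻¹‖ ≤ Real.exp (-c) ^ n := by
    filter_upwards [hlim.eventually (lt_mem_nhds hc), eventually_gt_atTop 0] with n hn hn0
    have hn' : (0 : ℝ) < n := Nat.cast_pos.2 hn0
    have hn : c < (p.r * (∑ i ∈ Finset.range n, W i)
        + ∑ i ∈ Finset.range n, Real.log (Z i)) / n := by
      rw [add_div, mul_div_assoc]
      exact hn
    rw [lt_div_iff₀ hn'] at hn
    rw [Real.norm_of_nonneg (inv_pos.2 (growthFactor_pos hZ n)).le, growthFactor_eq_exp hZ,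
      ← Real.exp_neg, ← Real.exp_nat_mul]
    refine Real.exp_le_exp.2 ?_
    rw [mul_neg, mul_comm (n : ℝ) c]
    exact neg_le_neg hn.le
  have hgeo : Summable fun n : ℕ => Real.exp (-c) ^ n :=
    summable_geometric_of_lt_one (Real.exp_pos _).le (Real.exp_lt_one_iff.2 (neg_lt_zero.2 hc0))
  have hs : Summable fun n => (p.growthFactor W Z n)⁻¹ :=
    Summable.of_norm_bounded_eventually_nat hgeo hev
  exact (summable_nat_add_iff (f := fun n => (p.growthFactor W Z n)⁻¹) 1).2 hs

theorem tendsto_lossTime {W : ℕ → ℝ} {a : ℝ} (ha : 0 < a)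
    (hlim : Tendsto (fun n : ℕ => (∑ i ∈ Finset.range n, W i) / n) atTop (𝓝 a)) :
    Tendsto (lossTime W) atTop atTop := by
  refine (hlim.pos_mul_atTop ha tendsto_natCast_atTop_atTop).congr' ?_
  filter_upwards [eventually_gt_atTop 0] with n hn
  have hn' : (n : ℝ) ≠ 0 := (Nat.cast_pos.2 hn).ne'
  rw [div_mul_cancel₀ _ hn', lossTime]

theorem tendsto_expectedPenalty_atTop {Ω : Type*} [MeasurableSpace Ω] {P : Measure Ω}
    [IsProbabilityMeasure P] (hp : p.Admissible) {lam δ : ℝ} (hlam : 0 < lam)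
    {ν : Measure ℝ} (hν : ∀ᵐ z ∂ν, z ∈ Icc (0 : ℝ) 1)
    {W Z : ℕ → Ω → ℝ} (hWZ : IsLossInput P lam ν W Z) (hδ : 0 ≤ δ) {w : ℝ → ℝ → ℝ}
    (hw0 : ∀ x₁ x₂, 0 ≤ x₁ → 0 < x₂ → x₂ ≤ p.xs → 0 ≤ w x₁ x₂)
    (hfin : ∀ x, p.xs ≤ x → Integrable
      (fun ω => p.discountedPenalty w δ (fun i => W i ω) (fun i => Z i ω) x) P) {C : ℝ}
    (hC : ∀ x₁ x₂, 0 ≤ x₁ → 0 < x₂ → x₂ ≤ p.xs → w x₁ x₂ ≤ C) (hν0 : ν {0} = 0)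
    (hcase : 0 < δ ∨ (Integrable Real.log ν ∧ lam * (∫ z, -Real.log z ∂ν) < p.r)) :
    Tendsto (p.expectedPenalty P W Z w δ) atTop (𝓝 0) := by
  have hpos : ∀ᵐ z ∂ν, 0 < z := by
    have hne : ∀ᵐ z ∂ν, z ≠ 0 := by simpa [ae_iff] using hν0
    filter_upwards [hν, hne] with z h1 h2
    exact lt_of_le_of_ne h1.1 (Ne.symm h2)
  have hpt : ∀ᵐ ω ∂P, Tendsto
      (fun x => p.discountedPenalty w δ (fun i => W i ω) (fun i => Z i ω) x) atTop (𝓝 0) := by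
    rcases hcase with hδ' | ⟨hlog, hnet⟩
    · filter_upwards [hWZ.ae_wait_pos, hWZ.ae_prop hpos, hWZ.ae_tendsto_wait hlam] with ω h1 h2 h3
      exact tendsto_discountedPenalty_of_discount hp hw0 hC hδ' h1 h2
        (tendsto_lossTime (one_div_pos.2 hlam) h3)
    · filter_upwards [hWZ.ae_wait_pos, hWZ.ae_prop hpos, hWZ.ae_tendsto_wait hlam,
        hWZ.ae_tendsto_log_prop hlog] with ω h1 h2 h3 h4
      refine tendsto_discountedPenalty_of_summable hp w δ h1 h2
        (summable_inv_growthFactor h2 h3 h4 ?_)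
      rw [integral_neg] at hnet
      -- The drift of the log growth per loss is positive exactly under the net profit condition.
      have : p.r * (1 / lam) + ∫ z, Real.log z ∂ν
          = (p.r - lam * -∫ z, Real.log z ∂ν) / lam := by
        field_simp
        ring
      rw [this]
      exact div_pos (sub_pos.2 hnet) hlam
  have hdom := tendsto_integral_filter_of_dominated_convergence (μ := P) (l := atTop)
    (F := fun x ω => p.discountedPenalty w δ (fun i => W i ω) (fun i => Z i ω) x)
    (f := fun _ => 0) (fun _ => max C 0)
    ((eventually_ge_atTop p.xs).mono fun x hx => (hfin x hx).aestronglyMeasurable) ?_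
    (integrable_const _) hpt
  · rwa [integral_zero] at hdom
  · filter_upwards [eventually_ge_atTop p.xs] with x hx
    filter_upwards [hWZ.ae_wait_pos, hWZ.ae_prop hpos] with ω h1 h2
    have hZ : ∀ i, 0 ≤ Z i ω := fun i => (h2 i).le
    rw [Real.norm_of_nonneg (discountedPenalty_nonneg hp hw0 δ hx h1 hZ)]
    rcases trappedAt_or (p := p) (W := fun i => W i ω) (Z := fun i => Z i ω) hx with ⟨n, hn⟩ | hA
    · rw [discountedPenalty_of_trappedAt hp w δ h1 hn]
      refine (penaltyAt_le hp hC δ h1 hZ hn).trans ?_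
      have h0 : 0 ≤ lossTime (fun i => W i ω) (n + 1) :=
        Finset.sum_nonneg fun i _ => (h1 i).le
      have he : Real.exp (-δ * lossTime (fun i => W i ω) (n + 1)) ≤ 1 :=
        Real.exp_le_one_iff.2 (by nlinarith)
      calc C * Real.exp (-δ * lossTime (fun i => W i ω) (n + 1))
          ≤ max C 0 * 1 := mul_le_mul (le_max_left _ _) he (Real.exp_pos _).le (le_max_right _ _)
        _ = max C 0 := mul_one _
    · rw [discountedPenalty_of_not_trapped hp w δ h1 hA]
      exact le_max_right _ _

/-! ### Continuity of the expected penalty at a trapping loss -/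

/-- Dominated convergence as for `survivalMean`, with the roles of the two sides of `x*/x`
exchanged. -/
theorem continuousOn_trappingLoss (hp : p.Admissible) {ν : Measure ℝ} [IsProbabilityMeasure ν]
    (hν : ∀ᵐ z ∂ν, z ∈ Icc (0 : ℝ) 1) {w : ℝ → ℝ → ℝ} (hw : Measurable (Function.uncurry w))
    (hw0 : ∀ x₁ x₂, 0 ≤ x₁ → 0 < x₂ → x₂ ≤ p.xs → 0 ≤ w x₁ x₂) (hatom : ∀ z, ν {z} = 0)
    (hwc : ContinuousOn (Function.uncurry w) (Ici 0 ×ˢ Ioc 0 p.xs)) {C : ℝ}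
    (hC : ∀ x₁ x₂, 0 ≤ x₁ → 0 < x₂ → x₂ ≤ p.xs → w x₁ x₂ ≤ C) :
    ContinuousOn (p.trappingLoss ν w) (Ici p.xs) := by
  intro x hx
  have hx0 : 0 < x := hp.xs_pos.trans_le hx
  have hrw : p.trappingLoss ν w = fun u => ∫ z, (Ico 0 (p.xs / u)).indicator
      (fun z => w (u - p.xs) (p.xs - u * z)) z ∂ν := by
    funext u
    rw [integral_indicator measurableSet_Ico, trappingLoss]
  have hne : ∀ᵐ z ∂ν, z ≠ p.xs / x := by simpa [ae_iff] using hatom (p.xs / x)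
  have hmem : ∀ {u z : ℝ}, p.xs ≤ u → 0 ≤ z → u * z < p.xs →
      (u - p.xs, p.xs - u * z) ∈ (Ici (0 : ℝ) ×ˢ Ioc 0 p.xs) := fun {u z} h1 h2 h3 => by
    have := mul_nonneg (hp.xs_pos.le.trans h1) h2
    exact ⟨sub_nonneg.2 h1, sub_pos.2 h3, by linarith⟩
  rw [hrw]
  refine continuousWithinAt_of_dominated (bound := fun _ => max C 0) ?_ ?_ (integrable_const _) ?_
  · exact Eventually.of_forall fun u => ((hw.comp (f := fun z => (u - p.xs, p.xs - u * z))
      (by fun_prop)).indicator measurableSet_Ico).aestronglyMeasurable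
  · filter_upwards [self_mem_nhdsWithin] with u hu
    have hu0 : 0 < u := hp.xs_pos.trans_le hu
    refine Eventually.of_forall fun z => ?_
    by_cases hz : z ∈ Ico 0 (p.xs / u)
    · rw [indicator_of_mem hz]
      have h1 : u * z < p.xs := by rw [mul_comm]; exact (lt_div_iff₀ hu0).1 hz.2
      obtain ⟨m1, m2, m3⟩ := hmem hu hz.1 h1
      rw [Real.norm_of_nonneg (hw0 _ _ m1 m2 m3)]
      exact (hC _ _ m1 m2 m3).trans (le_max_left _ _)
    · rw [indicator_of_notMem hz, norm_zero]
      exact le_max_right _ _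
  · filter_upwards [hν, hne] with z hz hzne
    have hcm : ContinuousWithinAt (fun u : ℝ => u * z) (Ici p.xs) x := by fun_prop
    rcases lt_or_gt_of_ne hzne with h | h
    · have h1 : x * z < p.xs := by rw [mul_comm]; exact (lt_div_iff₀ hx0).1 h
      have hlt := hcm.eventually (Iio_mem_nhds h1)
      have hev : (fun u => (Ico 0 (p.xs / u)).indicator
          (fun z => w (u - p.xs) (p.xs - u * z)) z) =ᶠ[𝓝[Ici p.xs] x]
          fun u => Function.uncurry w (u - p.xs, p.xs - u * z) := by
        filter_upwards [self_mem_nhdsWithin, hlt] with u hu hlt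
        have hu0 : 0 < u := hp.xs_pos.trans_le hu
        refine indicator_of_mem (show z ∈ Ico 0 (p.xs / u) from ⟨hz.1, (lt_div_iff₀ hu0).2 ?_⟩) _
        rw [mul_comm]
        exact hlt
      refine ContinuousWithinAt.congr_of_eventuallyEq ?_ hev (hev.self_of_nhdsWithin hx)
      refine (hwc _ (hmem hx hz.1 h1)).tendsto.comp (tendsto_nhdsWithin_iff.2 ⟨?_, ?_⟩)
      · have : ContinuousWithinAt (fun u : ℝ => (u - p.xs, p.xs - u * z)) (Ici p.xs) x := by
          fun_prop
        exact this
      · filter_upwards [self_mem_nhdsWithin, hlt] with u hu hlt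
        exact hmem hu hz.1 hlt
    · have h1 : p.xs < x * z := by rw [mul_comm]; exact (div_lt_iff₀ hx0).1 h
      have hev : (fun u => (Ico 0 (p.xs / u)).indicator
          (fun z => w (u - p.xs) (p.xs - u * z)) z) =ᶠ[𝓝[Ici p.xs] x] fun _ => 0 := by
        filter_upwards [self_mem_nhdsWithin, hcm.eventually (Ioi_mem_nhds h1)] with u hu hgt
        have hu0 : 0 < u := hp.xs_pos.trans_le hu
        refine indicator_of_notMem (fun hz' => ?_) _
        have h2 := (lt_div_iff₀ hu0).1 hz'.2
        have h3 : p.xs < u * z := hgt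
        linarith
      exact continuousWithinAt_const.congr_of_eventuallyEq hev (hev.self_of_nhdsWithin hx)

end CapitalParams

/-! ### The integro-differential equations and boundary conditions. -/

theorem theorem3p2 {Ω : Type*} [MeasurableSpace Ω] (P : Measure Ω) [IsProbabilityMeasure P]
    (p : CapitalParams) (hp : p.Admissible)
    (lam δ : ℝ) (hlam : 0 < lam) (hδ : 0 ≤ δ)
    (ν : Measure ℝ) [IsProbabilityMeasure ν] (hν : ∀ᵐ z ∂ν, z ∈ Icc (0 : ℝ) 1)
    (W Z : ℕ → Ω → ℝ) (hWZ : IsLossInput P lam ν W Z)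
    (w : ℝ → ℝ → ℝ) (hw : Measurable (Function.uncurry w))
    (hw0 : ∀ x₁ x₂, 0 ≤ x₁ → 0 < x₂ → x₂ ≤ p.xs → 0 ≤ w x₁ x₂)
    (hfin : ∀ x, p.xs ≤ x → Integrable
      (fun ω => p.discountedPenalty w δ (fun i => W i ω) (fun i => Z i ω) x) P)
    (mu ml : ℝ → ℝ)
    (hmu : ∀ x, p.B ≤ x → mu x = p.expectedPenalty P W Z w δ x)
    (hml : ∀ x, p.xs ≤ x → x < p.B → ml x = p.expectedPenalty P W Z w δ x) :
    -- the equation for `x ≥ B`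
    (∀ x, p.B ≤ x → ν {p.xs / x} = 0 → ContinuousWithinAt (p.trappingLoss ν w) (Ici p.B) x →
      IntegrableOn (fun z => mu (x * z)) (Icc (p.B / x) 1) ν ∧
      IntegrableOn (fun z => ml (x * z)) (Ico (p.xs / x) (p.B / x)) ν ∧
      DifferentiableWithinAt ℝ mu (Ici p.B) x ∧
      p.r * (x - p.xs) * derivWithin mu (Ici p.B) x - (lam + δ) * mu x
        + lam * ((∫ z in Icc (p.B / x) 1, mu (x * z) ∂ν)
          + (∫ z in Ico (p.xs / x) (p.B / x), ml (x * z) ∂ν) + p.trappingLoss ν w x) = 0) ∧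
    -- the equation for `x* ≤ x < B`
    (∀ x, p.xs ≤ x → x < p.B → ν {p.xs / x} = 0 →
      ContinuousWithinAt (p.trappingLoss ν w) (Ico p.xs p.B) x →
      IntegrableOn (fun z => ml (x * z)) (Icc (p.xs / x) 1) ν ∧
      DifferentiableWithinAt ℝ ml (Ico p.xs p.B) x ∧
      (p.r - p.cT) * (x + p.xss) * derivWithin ml (Ico p.xs p.B) x - (lam + δ) * ml x
        + lam * ((∫ z in Icc (p.xs / x) 1, ml (x * z) ∂ν) + p.trappingLoss ν w x) = 0) ∧
    -- continuity at `B`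
    Tendsto ml (𝓝[<] p.B) (𝓝 (mu p.B)) ∧
    -- the limit at infinity
    ((∃ C, ∀ x₁ x₂, 0 ≤ x₁ → 0 < x₂ → x₂ ≤ p.xs → w x₁ x₂ ≤ C) → ν {0} = 0 →
      (0 < δ ∨ (Integrable Real.log ν ∧ lam * (∫ z, -Real.log z ∂ν) < p.r)) →
      Tendsto mu atTop (𝓝 0)) ∧
    -- the relation at `x*`
    (ν {1} = 0 → ContinuousWithinAt (p.trappingLoss ν w) (Ico p.xs p.B) p.xs →
      ml p.xs = 1 / (lam + δ) * (p.cT * (p.B - p.xs) * derivWithin ml (Ico p.xs p.B) p.xs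
        + lam * p.trappingLoss ν w p.xs)) ∧
    -- the regularity required above holds at every point for continuous `G_Z` and `w`
    ((∀ z, ν {z} = 0) → ContinuousOn (Function.uncurry w) (Ici 0 ×ˢ Ioc 0 p.xs) →
      (∃ C, ∀ x₁ x₂, 0 ≤ x₁ → 0 < x₂ → x₂ ≤ p.xs → w x₁ x₂ ≤ C) →
      ContinuousOn (p.trappingLoss ν w) (Ici p.xs)) := by
  have hM : ∀ x, p.xs ≤ x → p.meanPenalty P W Z w δ x ≠ ⊤ := fun x hx =>
    CapitalParams.meanPenalty_ne_top hp hWZ hx (hfin x hx)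
  have hmu' : ∀ x, p.B ≤ x → mu x = p.realPenalty P W Z w δ x := fun x hx =>
    have hx' := hp.xs_lt_B.le.trans hx
    (hmu x hx).trans (CapitalParams.expectedPenalty_eq hp hWZ hν hw0 hx' (hfin x hx'))
  have hml' : ∀ x, p.xs ≤ x → x < p.B → ml x = p.realPenalty P W Z w δ x := fun x h1 h2 =>
    (hml x h1 h2).trans (CapitalParams.expectedPenalty_eq hp hWZ hν hw0 h1 (hfin x h1))
  have hcont := CapitalParams.continuousOn_realPenalty hp hlam hWZ hν hw hw0 hM
  have hmid : ∀ x, p.xs ≤ x → x < p.B → ν {p.xs / x} = 0 →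
      ContinuousWithinAt (p.trappingLoss ν w) (Ico p.xs p.B) x →
      IntegrableOn (fun z => ml (x * z)) (Icc (p.xs / x) 1) ν ∧
      DifferentiableWithinAt ℝ ml (Ico p.xs p.B) x ∧
      (p.r - p.cT) * (x + p.xss) * derivWithin ml (Ico p.xs p.B) x - (lam + δ) * ml x
        + lam * ((∫ z in Icc (p.xs / x) 1, ml (x * z) ∂ν) + p.trappingLoss ν w x) = 0 := by
    intro x hx hxB hatom hA
    have hx0 : 0 < x := hp.xs_pos.trans_le hx
    -- For `x < B` and `z ≤ 1` the capital `xz` stays below `B`, so only `ml` occurs.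
    have hcongr : EqOn (fun z => ml (x * z)) (fun z => p.realPenalty P W Z w δ (x * z))
        (Icc (p.xs / x) 1) := fun z hz => by
      have h1 := (div_le_iff₀ hx0).1 hz.1
      have h2 := mul_le_mul_of_nonneg_left hz.2 hx0.le
      exact hml' _ (by linarith) (by linarith)
    have hder := (CapitalParams.hasDerivWithinAt_realPenalty_mid hp hlam hWZ hν hw hw0 hM hx hxB
      hatom hA).congr (fun u hu => hml' u hu.1 hu.2) (hml' x hx hxB)
    refine ⟨(CapitalParams.integrableOn_realPenalty hp hWZ hw hcont hx).congr_fun hcongr.symm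
      measurableSet_Icc, hder.differentiableWithinAt, ?_⟩
    rw [hder.derivWithin (uniqueDiffOn_Ico _ _ x ⟨hx, hxB⟩), hml' x hx hxB,
      setIntegral_congr_fun measurableSet_Icc hcongr]
    have hne : (p.r - p.cT) * (x + p.xss) ≠ 0 := (CapitalParams.mid_pos hp hx hxB.le).ne'
    rw [mul_comm ((p.r - p.cT) * (x + p.xss)), mul_assoc _ _ ((p.r - p.cT) * (x + p.xss)),
      inv_mul_cancel₀ hne, CapitalParams.survivalMean]
    ring
  refine ⟨?_, hmid, ?_, ?_, ?_, ?_⟩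
  · intro x hx hatom hA
    have hxs : p.xs ≤ x := hp.xs_lt_B.le.trans hx
    have hx0 : 0 < x := hp.xs_pos.trans_le hxs
    have hBx : p.B / x ≤ 1 := (div_le_one hx0).2 hx
    have hle : p.xs / x ≤ p.B / x := (div_le_div_iff_of_pos_right hx0).2 hp.xs_lt_B.le
    have hcu : EqOn (fun z => mu (x * z)) (fun z => p.realPenalty P W Z w δ (x * z))
        (Icc (p.B / x) 1) := fun z hz => by
      have h1 := (div_le_iff₀ hx0).1 hz.1
      exact hmu' _ (by linarith)
    have hcl : EqOn (fun z => ml (x * z)) (fun z => p.realPenalty P W Z w δ (x * z))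
        (Ico (p.xs / x) (p.B / x)) := fun z hz => by
      have h1 := (div_le_iff₀ hx0).1 hz.1
      have h2 := (lt_div_iff₀ hx0).1 hz.2
      exact hml' _ (by linarith) (by linarith)
    have hint := CapitalParams.integrableOn_realPenalty hp hWZ hw hcont hxs
    -- The split at `B/x` only separates the names `mu` and `ml`; both pieces are integrals of one
    -- function, recombined into `survivalMean`.
    have hunion : Icc (p.B / x) 1 ∪ Ico (p.xs / x) (p.B / x) = Icc (p.xs / x) 1 := by
      rw [union_comm, Ico_union_Icc_eq_Icc hle hBx]
    rw [← hunion] at hint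
    have hdisj : Disjoint (Icc (p.B / x) 1) (Ico (p.xs / x) (p.B / x)) :=
      Set.disjoint_left.2 fun z h1 h2 => absurd h2.2 (not_lt.2 h1.1)
    have hder := (CapitalParams.hasDerivWithinAt_realPenalty_top hp hlam hWZ hν hw hw0 hM hx
      hatom hA).congr (fun u hu => hmu' u hu) (hmu' x hx)
    refine ⟨hint.left_of_union.congr_fun hcu.symm measurableSet_Icc,
      hint.right_of_union.congr_fun hcl.symm measurableSet_Ico, hder.differentiableWithinAt, ?_⟩
    have hne : p.r * (x - p.xs) ≠ 0 :=
      (mul_pos hp.r_pos (by linarith [hp.xs_lt_B])).ne'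
    rw [hder.derivWithin (uniqueDiffOn_Ici _ x hx), hmu' x hx,
      setIntegral_congr_fun measurableSet_Icc hcu, setIntegral_congr_fun measurableSet_Ico hcl,
      ← setIntegral_union hdisj measurableSet_Ico hint.left_of_union hint.right_of_union, hunion,
      mul_comm (p.r * (x - p.xs)), mul_assoc _ _ (p.r * (x - p.xs)), inv_mul_cancel₀ hne,
      CapitalParams.survivalMean]
    ring
  · have hB := (hcont p.B hp.xs_lt_B.le).continuousAt (Ici_mem_nhds hp.xs_lt_B)
    rw [hmu' p.B le_rfl]
    refine (hB.tendsto.mono_left nhdsWithin_le_nhds).congr' ?_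
    filter_upwards [Ico_mem_nhdsLT hp.xs_lt_B] with x hx
    exact (hml' x hx.1 hx.2).symm
  · rintro ⟨C, hC⟩ hν0 hcase
    refine (CapitalParams.tendsto_expectedPenalty_atTop hp hlam hν hWZ hδ hw0 hfin hC hν0
      hcase).congr' ?_
    filter_upwards [eventually_ge_atTop p.B] with x hx
    exact (hmu x hx).symm
  · intro hν1 hA
    have hone : p.xs / p.xs = 1 := div_self hp.xs_pos.ne'
    obtain ⟨-, -, h⟩ := hmid p.xs le_rfl hp.xs_lt_B (by rwa [hone]) hA
    -- At `x*` the integral runs over `{1}`, a null set, and the speed `(r - c_T)(x* + x**)` equals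
    -- `c_T (B - x*)`.
    rw [hone, Icc_self, Measure.restrict_eq_zero.2 hν1, integral_zero_measure, zero_add,
      CapitalParams.mid_eq hp, sub_self, mul_zero, zero_add] at h
    have hne : lam + δ ≠ 0 := by linarith
    rw [one_div, eq_inv_mul_iff_mul_eq₀ hne]
    linarith
  · rintro hatom hwc ⟨C, hC⟩
    exact CapitalParams.continuousOn_trappingLoss hp hν hw hw0 hatom hwc hC
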